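/- For a real number $x>0$ let $$\Theta(r,s,t,x)=\sum_{n=1}^{\infty}\sum_{m=1}^{\infty}\frac{1}{n^{r}m^{s}(n+mx)^{t}},$$ which converges absolutely for $\Re(r+t)>1$, $\Re(s+t)>1$, $\Re(r+s+t)>2$. In particular $\Theta(s,s,s,x)$ is given by an absolutely convergent double series for $\Re(s)>\tfrac23$; as a function of the single complex variable $s$ it has a (unique) meromorphic continuation to $\mathbb{C}$, again denoted $\Theta(s,s,s,x)$. Let $\zeta$ be the Riemann zeta function. Then for every non-negative integer $j$ the limit of $\Theta(s,s,s,x)$ as $s\to -j$ (through complex $s\neq -j$) exists, and: 1. if $j$ is odd, then $\displaystyle\lim_{s\to -j}\Theta(s,s,s,x)=0$; 2. if $j$ is even, then $$\lim_{s\to -j}\Theta(s,s,s,x)=-\frac{(j!)^2}{2(2j+1)!}\left(x^{2j+1}+x^{-j-1}\right)\zeta(-3j-1)+\sum_{k=0}^{j}\binom{j}{k}x^{j-k}\zeta(-j-k)\zeta(-2j+k).$$ -/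

import Mathlib

open Filter Topology

/-- The general term of the generalized Mordell-Tornheim double series
`∑_{n ≥ 1} ∑_{m ≥ 1} 1 / (n ^ r * m ^ s * (n + m x) ^ t)`; the pair `p : ℕ × ℕ` stands for
`n = p.1 + 1` and `m = p.2 + 1`. For `x > 0` all three bases are positive reals, so the powers
are the usual ones. -/
noncomputable def thetaTerm (r s t : ℂ) (x : ℝ) (p : ℕ × ℕ) : ℂ :=
  1 / (((p.1 : ℂ) + 1) ^ r * ((p.2 : ℂ) + 1) ^ s *
    (((p.1 : ℂ) + 1) + ((p.2 : ℂ) + 1) * (x : ℂ)) ^ t)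

/-- `F` is the meromorphic continuation of `s ↦ Θ(s, s, s, x)` to the whole complex plane:
`F` is meromorphic at every point, and in the half-plane `Re s > 2/3` the double series
converges absolutely (unconditionally) with sum `F s`. -/
structure IsThetaDiagContinuation (x : ℝ) (F : ℂ → ℂ) : Prop where
  meromorphicAt : ∀ s : ℂ, MeromorphicAt F s
  hasSum : ∀ s : ℂ, 2 / 3 < s.re → HasSum (thetaTerm s s s x) (F s)

/-! Expanding both polylogarithms gives, for `Re s > 2/3`, `Γ(s) Θ(s,s,s,x) = ∫₀^∞ t^(s-1)
Li_s(e^{-t}) Li_s(e^{-xt}) dt` (`Gamma_mul_thetaSeries`). The tail over `(1, ∞)` is entire in `s`,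
so all singularities come from `t → 0`. There, for `Re s < 1`, `Li_s(e^{-t}) = Γ(1-s) t^(s-1) +
∑_{k<N} (-1)^k ζ(s-k)/k! t^k + O(t^N)`, locally uniformly in `s`
(`exists_eventually_norm_polylogRem_le`). Multiplying two such expansions and integrating over
`(0,1]` gives an analytic remainder plus the explicit fractions of `thetaPolar`, with denominators
`3s-2`, `2s-1+k` and `s+k+l`. This continues `Θ` to `1 - N/2 < Re s < 1`, and `N` is arbitrary.

At `s = -j` the factor `1/Γ(s)` has a simple zero with derivative `(-1)^j j!`. It kills everything
except the fractions having a pole there: `k = 2j+1` in the second family gives the term with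
`ζ(-3j-1)`, and `k+l = j` in the third gives the binomial sum. For odd `j` every term contains a
trivial zero of `ζ`.

The expansion of the polylogarithm starts from Lipschitz's formula for `Re s < 0`, a case of Poisson
summation. Its limit at `t = 0` is the functional equation of `ζ`. Since `d/dt` lowers `s` by one,
integration in `t` yields the higher Taylor terms and the range `Re s < 1`. -/

namespace MordellTornheim
open Set MeasureTheory

/-! ### The polylogarithm at `e^{-t}`: convergence, derivative, decay. -/

lemma norm_natCast_add_one_cpow (n : ℕ) (s : ℂ) :
    ‖((n : ℂ) + 1) ^ s‖ = ((n : ℝ) + 1) ^ s.re := by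
  have h : ((n : ℂ) + 1) = (((n : ℝ) + 1 : ℝ) : ℂ) := by push_cast; rfl
  rw [h, Complex.norm_cpow_eq_rpow_re_of_pos (by positivity)]

lemma summable_rpow_mul_exp (c : ℝ) {δ : ℝ} (hδ : 0 < δ) :
    Summable fun n : ℕ ↦ ((n : ℝ) + 1) ^ c * Real.exp (-((n : ℝ) + 1) * δ) := by
  obtain ⟨k, hk⟩ := exists_nat_ge c
  have h := (summable_nat_add_iff 1).mpr (Real.summable_pow_mul_exp_neg_nat_mul k hδ)
  refine h.of_nonneg_of_le (fun n ↦ by positivity) fun n ↦ ?_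
  push_cast
  rw [← Real.rpow_natCast]
  have h2 : -((n : ℝ) + 1) * δ = -δ * ((n : ℝ) + 1) := by ring
  rw [h2]
  gcongr
  linarith [n.cast_nonneg (α := ℝ)]

/-- The polylogarithm `Li_s(e^{-t})` as a Dirichlet-type series in the variable `t`. -/
noncomputable def polylogExp (s : ℂ) (t : ℝ) : ℂ :=
  ∑' n : ℕ, ((n : ℂ) + 1) ^ (-s) * (Real.exp (-((n : ℝ) + 1) * t) : ℂ)

lemma norm_polylogExp_term (s : ℂ) (t : ℝ) (n : ℕ) :
    ‖((n : ℂ) + 1) ^ (-s) * (Real.exp (-((n : ℝ) + 1) * t) : ℂ)‖ =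
      ((n : ℝ) + 1) ^ (-s.re) * Real.exp (-((n : ℝ) + 1) * t) := by
  rw [norm_mul, norm_natCast_add_one_cpow, Complex.norm_real, Real.norm_of_nonneg (by positivity),
    Complex.neg_re]

lemma summable_norm_polylogExp_term (s : ℂ) {t : ℝ} (ht : 0 < t) :
    Summable fun n : ℕ ↦ ‖((n : ℂ) + 1) ^ (-s) * (Real.exp (-((n : ℝ) + 1) * t) : ℂ)‖ := by
  simp_rw [norm_polylogExp_term]
  exact summable_rpow_mul_exp _ ht

lemma hasSum_polylogExp (s : ℂ) {t : ℝ} (ht : 0 < t) :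
    HasSum (fun n : ℕ ↦ ((n : ℂ) + 1) ^ (-s) * (Real.exp (-((n : ℝ) + 1) * t) : ℂ))
      (polylogExp s t) :=
  (summable_norm_polylogExp_term s ht).of_norm.hasSum

lemma differentiable_polylogExp {t : ℝ} (ht : 0 < t) :
    Differentiable ℂ fun s ↦ polylogExp s t := by
  intro s₀
  have h : DifferentiableOn ℂ (fun s ↦ polylogExp s t) {s | s₀.re - 1 < s.re} := by
    refine Complex.differentiableOn_tsum_of_summable_norm
      (summable_rpow_mul_exp (-(s₀.re - 1)) ht) (fun n ↦ ?_)
      (isOpen_lt continuous_const Complex.continuous_re) fun n s hs ↦ ?_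
    · refine Differentiable.differentiableOn ?_
      have : (n : ℂ) + 1 ≠ 0 := Nat.cast_add_one_ne_zero n
      intro s
      refine DifferentiableAt.mul_const ?_ _
      exact differentiableAt_id.neg.const_cpow (Or.inl this)
    · rw [norm_polylogExp_term]
      have hs' : s₀.re - 1 < s.re := hs
      gcongr
      linarith [n.cast_nonneg (α := ℝ)]
  exact (h s₀ (by simp)).differentiableAt
    ((isOpen_lt continuous_const Complex.continuous_re).mem_nhds (by simp))

lemma hasDerivAt_polylogExp (s : ℂ) {t : ℝ} (ht : 0 < t) :
    HasDerivAt (polylogExp s) (-polylogExp (s - 1) t) t := by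
  have key : ∀ (n : ℕ) (y : ℝ),
      HasDerivAt (fun y : ℝ ↦ ((n : ℂ) + 1) ^ (-s) * (Real.exp (-((n : ℝ) + 1) * y) : ℂ))
        (-(((n : ℂ) + 1) ^ (-(s - 1)) * (Real.exp (-((n : ℝ) + 1) * y) : ℂ))) y := by
    intro n y
    have h1 : HasDerivAt (fun y : ℝ ↦ Real.exp (-((n : ℝ) + 1) * y))
        (Real.exp (-((n : ℝ) + 1) * y) * (-((n : ℝ) + 1) * 1)) y :=
      ((hasDerivAt_id y).const_mul _).exp
    convert! h1.ofReal_comp.const_mul (((n : ℂ) + 1) ^ (-s)) using 1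
    have h0 : (n : ℂ) + 1 ≠ 0 := Nat.cast_add_one_ne_zero n
    rw [show -(s - 1) = -s + 1 by ring, Complex.cpow_add _ _ h0, Complex.cpow_one]
    push_cast
    ring
  have h := hasDerivAt_tsum_of_isPreconnected (t := Ioi (t / 2)) (y₀ := t) (y := t)
    (summable_rpow_mul_exp (-(s - 1).re) (half_pos ht)) isOpen_Ioi isPreconnected_Ioi
    (fun n y _ ↦ key n y) (fun n y hy ↦ ?_) (by simpa using ht)
    (summable_norm_polylogExp_term s ht).of_norm (by simpa using ht)
  · rw [tsum_neg] at h
    exact h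
  · rw [norm_neg, norm_polylogExp_term]
    have hy' : t / 2 < y := hy
    gcongr ?_ * Real.exp ?_
    nlinarith [n.cast_nonneg (α := ℝ)]

lemma continuousOn_polylogExp (s : ℂ) : ContinuousOn (polylogExp s) (Ioi 0) := fun _ ht ↦
  (hasDerivAt_polylogExp s ht).continuousAt.continuousWithinAt

/-- Half of each exponent pays for convergence and half for decay: `(n+1)t ≥ (n+1)δ/2 + t/2`. -/
lemma exists_norm_polylogExp_le (σ : ℝ) {δ : ℝ} (hδ : 0 < δ) :
    ∃ C : ℝ, 0 ≤ C ∧ ∀ s : ℂ, σ ≤ s.re → ∀ t : ℝ, δ ≤ t →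
      ‖polylogExp s t‖ ≤ C * Real.exp (-(t / 2)) := by
  refine ⟨∑' n : ℕ, ((n : ℝ) + 1) ^ (-σ) * Real.exp (-((n : ℝ) + 1) * (δ / 2)),
    tsum_nonneg fun n ↦ by positivity, fun s hs t ht ↦ ?_⟩
  have hS := summable_rpow_mul_exp (-σ) (half_pos hδ)
  rw [← tsum_mul_right]
  refine tsum_of_norm_bounded (hS.mul_right _).hasSum fun n ↦ ?_
  rw [norm_polylogExp_term, mul_assoc, ← Real.exp_add]
  have hn := n.cast_nonneg (α := ℝ)
  gcongr ?_ * Real.exp ?_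
  · gcongr
    linarith
  · nlinarith

/-! ### Holomorphy of integrals depending on a complex parameter. -/

/-- No bound on the derivative is assumed: Cauchy's estimate on circles of radius `r/4` turns the
bound `g` into `g / (r/4)`. -/
lemma analyticAt_integral {α : Type*} [MeasurableSpace α] {μ : Measure α} {f : ℂ → α → ℂ}
    {s₀ : ℂ} {ε : ℝ} (hε : 0 < ε) {g : α → ℝ} (hg : Integrable g μ)
    (hmeas : ∀ s ∈ Metric.ball s₀ ε, AEStronglyMeasurable (f s) μ)
    (hdiff : ∀ᵐ t ∂μ, DifferentiableOn ℂ (fun s ↦ f s t) (Metric.ball s₀ ε))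
    (hbound : ∀ᵐ t ∂μ, ∀ s ∈ Metric.ball s₀ ε, ‖f s t‖ ≤ g t) :
    AnalyticAt ℂ (fun s ↦ ∫ t, f s t ∂μ) s₀ := by
  have hd : DifferentiableOn ℂ (fun s ↦ ∫ t, f s t ∂μ) (Metric.ball s₀ ε) := by
    intro s₁ hs₁
    obtain ⟨r, hr, hsub⟩ := Metric.isOpen_iff.mp Metric.isOpen_ball s₁ hs₁
    have hsub' : ∀ s ∈ Metric.ball s₁ (r / 2), Metric.closedBall s (r / 4) ⊆ Metric.ball s₀ ε := by
      intro s hs z hz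
      apply hsub
      rw [Metric.mem_ball] at hs ⊢
      rw [Metric.mem_closedBall] at hz
      linarith [dist_triangle z s s₁]
    have hmem : Metric.ball s₁ (r / 2) ∈ 𝓝 s₁ := Metric.ball_mem_nhds _ (half_pos hr)
    have hball : ∀ s ∈ Metric.ball s₁ (r / 2), s ∈ Metric.ball s₀ ε := fun s hs ↦
      hsub' s hs (Metric.mem_closedBall_self (by positivity))
    have hderiv : ∀ᵐ t ∂μ, ∀ s ∈ Metric.ball s₁ (r / 2),
        HasDerivAt (fun s ↦ f s t) (deriv (fun s ↦ f s t) s) s := by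
      filter_upwards [hdiff] with t ht s hs
      exact (ht.differentiableAt (Metric.isOpen_ball.mem_nhds (hball s hs))).hasDerivAt
    refine (hasDerivAt_integral_of_dominated_loc_of_deriv_le (F := f)
      (F' := fun s t ↦ deriv (fun s ↦ f s t) s) (bound := fun t ↦ g t / (r / 4))
      hmem ?_ ?_ ?_ ?_ (hg.div_const _) hderiv).2.differentiableAt.differentiableWithinAt
    · filter_upwards [hmem] with s hs using hmeas s (hball s hs)
    · refine hg.mono' (hmeas s₁ hs₁) ?_
      filter_upwards [hbound] with t ht using ht s₁ hs₁
    -- Measurability of the derivative in `t`: it is the pointwise limit of difference quotients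
    -- along a sequence of steps tending to zero.
    · have hpos : ∀ n : ℕ, (0 : ℝ) < r / 4 / ((n : ℝ) + 1) := fun n ↦ by positivity
      have hin : ∀ n : ℕ, s₁ + ((r / 4 / ((n : ℝ) + 1) : ℝ) : ℂ) ∈ Metric.ball s₀ ε := by
        intro n
        refine hsub' s₁ (Metric.mem_ball_self (half_pos hr)) ?_
        rw [Metric.mem_closedBall, dist_self_add_left, Complex.norm_real,
          Real.norm_of_nonneg (hpos n).le]
        exact div_le_self (by positivity) (by linarith [n.cast_nonneg (α := ℝ)])
      refine aestronglyMeasurable_of_tendsto_ae atTop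
        (f := fun (n : ℕ) t ↦ (((r / 4 / ((n : ℝ) + 1) : ℝ) : ℂ))⁻¹ •
          (f (s₁ + ((r / 4 / ((n : ℝ) + 1) : ℝ) : ℂ)) t - f s₁ t))
        (fun n ↦ by
          have h1 := ((hmeas _ (hin n)).sub (hmeas s₁ hs₁)).const_smul
            (((r / 4 / ((n : ℝ) + 1) : ℝ) : ℂ))⁻¹
          exact h1) ?_
      filter_upwards [hderiv] with t ht
      have h0 := (ht s₁ (Metric.mem_ball_self (half_pos hr))).tendsto_slope_zero
      refine h0.comp (tendsto_nhdsWithin_iff.mpr ⟨?_, Eventually.of_forall fun n ↦ ?_⟩)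
      · have h1 : Tendsto (fun n : ℕ ↦ r / 4 / ((n : ℝ) + 1)) atTop (𝓝 0) :=
          tendsto_const_nhds.div_atTop (tendsto_natCast_atTop_atTop.atTop_add tendsto_const_nhds)
        have := (Complex.continuous_ofReal.tendsto 0).comp h1
        simpa [Function.comp_def] using this
      · rw [mem_compl_singleton_iff]
        exact Complex.ofReal_ne_zero.mpr (hpos n).ne'
    · filter_upwards [hdiff, hbound] with t h1 h2 s hs
      refine Complex.norm_deriv_le_of_forall_mem_sphere_norm_le (by positivity) ?_ fun z hz ↦
        h2 z (hsub' s hs (Metric.sphere_subset_closedBall hz))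
      exact (h1.mono (hsub' s hs)).diffContOnCl_ball Subset.rfl
  exact hd.analyticAt (Metric.ball_mem_nhds _ hε)

/-! ### The Gamma integral with complex rate. -/

lemma integrableOn_rpow_mul_exp_neg {c r : ℝ} (hc : -1 < c) (hr : 0 < r) :
    IntegrableOn (fun u : ℝ ↦ u ^ c * Real.exp (-(r * u))) (Ioi 0) := by
  have := integrableOn_rpow_mul_exp_neg_mul_rpow hc zero_lt_one hr
  simpa using this

lemma continuousOn_ofReal_cpow (w : ℂ) : ContinuousOn (fun t : ℝ ↦ (t : ℂ) ^ w) (Ioi 0) :=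
  fun t ht ↦ (Complex.continuousAt_ofReal_cpow_const t w (Or.inr (ne_of_gt ht))).continuousWithinAt

lemma norm_cpow_mul_cexp_neg (a z : ℂ) {u : ℝ} (hu : 0 < u) :
    ‖(u : ℂ) ^ (a - 1) * Complex.exp (-(z * u))‖ = u ^ (a.re - 1) * Real.exp (-(z.re * u)) := by
  rw [norm_mul, Complex.norm_cpow_eq_rpow_re_of_pos hu, Complex.norm_exp]
  simp

/-- The Gamma integral with a complex rate in the right half-plane. -/
lemma integral_cpow_mul_cexp_neg_mul_Ioi {a z : ℂ} (ha : 0 < a.re) (hz : 0 < z.re) :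
    ∫ u : ℝ in Ioi 0, (u : ℂ) ^ (a - 1) * Complex.exp (-(z * u)) = z ^ (-a) * Complex.Gamma a := by
  let U : Set ℂ := {z | 0 < z.re}
  have hU : IsOpen U := isOpen_lt continuous_const Complex.continuous_re
  have hcont : ∀ z : ℂ, AEStronglyMeasurable
      (fun u : ℝ ↦ (u : ℂ) ^ (a - 1) * Complex.exp (-(z * u))) (volume.restrict (Ioi 0)) :=
    fun z ↦ ContinuousOn.aestronglyMeasurable
      ((continuousOn_ofReal_cpow _).mul (by fun_prop)) measurableSet_Ioi
  have h1 : AnalyticOnNhd ℂ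
      (fun z : ℂ ↦ ∫ u : ℝ in Ioi 0, (u : ℂ) ^ (a - 1) * Complex.exp (-(z * u))) U := by
    intro z hz
    have hz' : 0 < z.re := hz
    refine analyticAt_integral (half_pos hz')
      (integrableOn_rpow_mul_exp_neg (c := a.re - 1) (by linarith) (half_pos hz'))
      (fun s _ ↦ hcont s) (ae_of_all _ fun t ↦ by fun_prop) ?_
    refine (ae_restrict_iff' measurableSet_Ioi).mpr (ae_of_all _ fun u hu s hs ↦ ?_)
    have hu' : 0 < u := hu
    rw [norm_cpow_mul_cexp_neg _ _ hu']
    have h2 : z.re / 2 ≤ s.re := by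
      have := (Complex.abs_re_le_norm (s - z)).trans (mem_ball_iff_norm.mp hs).le
      rw [abs_le, Complex.sub_re] at this
      linarith [this.1]
    gcongr
  have h2 : AnalyticOnNhd ℂ (fun z : ℂ ↦ z ^ (-a) * Complex.Gamma a) U := by
    intro z hz
    exact (analyticAt_id.cpow analyticAt_const (Or.inl hz)).mul analyticAt_const
  -- Both sides are holomorphic in `z`, so it suffices to compare them at real points `1 + 1/(n+1)`
  -- accumulating at `1`.
  refine h1.eqOn_of_preconnected_of_frequently_eq h2 ?_ (z₀ := 1) (by simp [U]) ?_ hz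
  · exact (convex_halfSpace_re_gt 0).isPreconnected
  · have hlim : Tendsto (fun n : ℕ ↦ (((1 + 1 / ((n : ℝ) + 1) : ℝ)) : ℂ)) atTop (𝓝[≠] 1) := by
      refine tendsto_nhdsWithin_iff.mpr ⟨?_, Eventually.of_forall fun n ↦ ?_⟩
      · have h := (Complex.continuous_ofReal.tendsto _).comp
          ((tendsto_one_div_add_atTop_nhds_zero_nat (𝕜 := ℝ)).const_add 1)
        simpa [Function.comp_def] using h
      · rw [mem_compl_singleton_iff]
        have : (0 : ℝ) < 1 / ((n : ℝ) + 1) := by positivity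
        intro h
        rw [← Complex.ofReal_one, Complex.ofReal_inj] at h
        linarith
    refine hlim.frequently (Frequently.of_forall fun n ↦ ?_)
    have hr : (0 : ℝ) < 1 + 1 / ((n : ℝ) + 1) := by positivity
    rw [Complex.integral_cpow_mul_exp_neg_mul_Ioi ha hr, one_div,
      Complex.inv_cpow_ofReal_nonneg hr.le, Complex.cpow_neg]

/-! ### Lipschitz's formula by Poisson summation. -/

/-- The point `t + 2πik` of the pole lattice of `1 / (e^t - 1)`, shifted by `t`. -/
noncomputable def latticePoint (t : ℝ) (y : ℝ) : ℂ := t + 2 * Real.pi * y * Complex.I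

@[simp] lemma latticePoint_re (t y : ℝ) : (latticePoint t y).re = t := by
  simp [latticePoint]

@[simp] lemma latticePoint_im (t y : ℝ) : (latticePoint t y).im = 2 * Real.pi * y := by
  simp [latticePoint]

lemma abs_le_norm_latticePoint (t y : ℝ) : |y| ≤ ‖latticePoint t y‖ := by
  refine le_trans ?_ (Complex.abs_im_le_norm _)
  rw [latticePoint_im, abs_mul, abs_of_pos (by positivity : 0 < 2 * Real.pi)]
  have := abs_nonneg y
  nlinarith [Real.pi_gt_three]

/-- The bound is independent of `t`, which permits dominated convergence as `t → 0`. -/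
lemma norm_latticePoint_cpow_le {w : ℂ} (hw : w.re ≤ 0) (t : ℝ) {y : ℝ} (hy : y ≠ 0) :
    ‖latticePoint t y ^ w‖ ≤ |y| ^ w.re * Real.exp (Real.pi * |w.im|) := by
  have hy' : 0 < |y| := abs_pos.mpr hy
  have h1 := abs_le_norm_latticePoint t y
  refine (Complex.norm_cpow_le _ _).trans ?_
  rw [div_eq_mul_inv, ← Real.exp_neg]
  gcongr ?_ * Real.exp ?_
  · exact Real.rpow_le_rpow_of_nonpos hy' h1 hw
  · refine (neg_le_abs _).trans ?_
    rw [abs_mul]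
    gcongr
    exact Complex.abs_arg_le_pi _

lemma summable_latticePoint_cpow {w : ℂ} (hw : w.re < -1) (t : ℝ) :
    Summable fun k : ℤ ↦ latticePoint t k ^ w := by
  have hS := (Real.summable_abs_int_rpow (b := -w.re) (by linarith)).mul_right
    (Real.exp (Real.pi * |w.im|))
  refine hS.of_norm_bounded_eventually ?_
  filter_upwards [(finite_singleton (0 : ℤ)).compl_mem_cofinite] with k hk
  have hk' : (k : ℝ) ≠ 0 := Int.cast_ne_zero.mpr hk
  simpa using norm_latticePoint_cpow_le (by linarith) t hk'

/-- `u^{-s} e^{-tu}` on the positive half-line, extended by zero. -/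
noncomputable def truncatedTerm (s : ℂ) (t u : ℝ) : ℂ :=
  ((max u 0 : ℝ) : ℂ) ^ (-s) * (Real.exp (-u * t) : ℂ)

lemma truncatedTerm_of_nonpos {s : ℂ} (hs : s.re < 0) (t : ℝ) {u : ℝ} (hu : u ≤ 0) :
    truncatedTerm s t u = 0 := by
  have : -s ≠ 0 := by
    rintro h
    rw [neg_eq_zero] at h
    simp [h] at hs
  simp [truncatedTerm, max_eq_right hu, Complex.zero_cpow this]

lemma continuous_truncatedTerm {s : ℂ} (hs : s.re < 0) (t : ℝ) :
    Continuous (truncatedTerm s t) := by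
  refine Continuous.mul ?_ (by fun_prop)
  exact (Complex.continuous_ofReal_cpow_const (by simpa using hs)).comp (by fun_prop)

lemma isBigO_truncatedTerm {s : ℂ} (hs : s.re < 0) {t : ℝ} (ht : 0 < t) :
    truncatedTerm s t =O[cocompact ℝ] fun u ↦ |u| ^ (-2 : ℝ) := by
  rw [cocompact_eq_atBot_atTop, Asymptotics.isBigO_sup]
  constructor
  · refine (EventuallyEq.isBigO (f₂ := fun _ ↦ (0 : ℂ)) ?_).trans (Asymptotics.isBigO_zero _ _)
    filter_upwards [eventually_le_atBot 0] with u hu using truncatedTerm_of_nonpos hs t hu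
  -- The exponent `s.re - 2` is chosen so that multiplying by `u ^ (-s.re)` leaves `u ^ (-2)`.
  · have h1 := (isLittleO_exp_neg_mul_rpow_atTop ht (s.re - 2)).isBigO
    have h2 := (Asymptotics.isBigO_refl (fun u : ℝ ↦ u ^ (-s.re)) atTop).mul h1
    refine Asymptotics.IsBigO.congr' (Asymptotics.isBigO_norm_left.mp ?_) .rfl
      (f₁ := truncatedTerm s t) (g₁ := fun u : ℝ ↦ u ^ (-s.re) * u ^ (s.re - 2)) .rfl |>.congr' .rfl ?_
    · refine h2.congr' ?_ .rfl
      filter_upwards [eventually_gt_atTop 0] with u hu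
      rw [truncatedTerm, max_eq_left hu.le, norm_mul, Complex.norm_cpow_eq_rpow_re_of_pos hu,
        Complex.norm_real, Real.norm_of_nonneg (by positivity), Complex.neg_re]
      ring_nf
    · filter_upwards [eventually_gt_atTop 0] with u hu
      rw [← Real.rpow_add hu, abs_of_pos hu]
      ring_nf

open FourierTransform in
-- The Fourier kernel merges with `e^{-tu}` into a Gamma integral of rate `t + 2πiy`.
lemma fourier_truncatedTerm {s : ℂ} (hs : s.re < 0) {t : ℝ} (ht : 0 < t) (y : ℝ) :
    𝓕 (truncatedTerm s t) y = Complex.Gamma (1 - s) * latticePoint t y ^ (s - 1) := by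
  rw [Real.fourier_real_eq_integral_exp_smul,
    ← setIntegral_eq_integral_of_forall_compl_eq_zero (s := Ioi 0) fun u hu ↦ ?_]
  · have h := integral_cpow_mul_cexp_neg_mul_Ioi (a := 1 - s) (z := latticePoint t y)
      (by simp; linarith) (by simpa)
    rw [neg_sub, mul_comm] at h
    rw [← h]
    refine setIntegral_congr_fun measurableSet_Ioi fun u hu ↦ ?_
    have hu' : 0 < u := hu
    simp only [truncatedTerm, max_eq_left hu'.le, smul_eq_mul, latticePoint]
    rw [mul_left_comm, Complex.ofReal_exp, ← Complex.exp_add]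
    congr 2
    · ring
    · push_cast
      ring
  · rw [truncatedTerm_of_nonpos hs t (not_lt.mp hu), smul_zero]

/-- The polylogarithm with its singular part at `t = 0` removed. -/
noncomputable def polylogReg (s : ℂ) (t : ℝ) : ℂ :=
  polylogExp s t - Complex.Gamma (1 - s) * (t : ℂ) ^ (s - 1)

/-- Lipschitz's summation formula. -/
lemma polylogReg_eq_tsum {s : ℂ} (hs : s.re < 0) {t : ℝ} (ht : 0 < t) :
    polylogReg s t = Complex.Gamma (1 - s) * ∑' n : ℕ,
      (latticePoint t (n + 1) ^ (s - 1) + latticePoint t (-(n + 1)) ^ (s - 1)) := by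
  have hsum := summable_latticePoint_cpow (w := s - 1)
    (by rw [Complex.sub_re, Complex.one_re]; linarith) t
  have hinj1 : Function.Injective fun n : ℕ ↦ ((n : ℤ) + 1) := fun a b h ↦ by simpa using h
  have hinj2 : Function.Injective fun n : ℕ ↦ (-((n : ℤ) + 1)) := fun a b h ↦ by simpa using h
  have hs1 := hsum.comp_injective hinj1
  have hs2 := hsum.comp_injective hinj2
  have hP := Real.tsum_eq_tsum_fourier_of_rpow_decay_of_summable (continuous_truncatedTerm hs t)
    one_lt_two (isBigO_truncatedTerm hs ht)
    (by simpa only [fourier_truncatedTerm hs ht] using hsum.mul_left (Complex.Gamma (1 - s))) 0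
  simp only [fourier_truncatedTerm hs ht, zero_add, QuotientAddGroup.mk_zero, fourier_eval_zero,
    mul_one, tsum_mul_left] at hP
  have hterm : ∀ n : ℕ, truncatedTerm s t (((n : ℤ) + 1 : ℤ) : ℝ) =
      ((n : ℂ) + 1) ^ (-s) * (Real.exp (-((n : ℝ) + 1) * t) : ℂ) := by
    intro n
    have : (0 : ℝ) ≤ (n : ℝ) + 1 := by positivity
    simp only [truncatedTerm]
    push_cast
    rw [max_eq_left this]
    push_cast
    rfl
  have hneg : ∀ n : ℕ, truncatedTerm s t ((-((n : ℤ) + 1) : ℤ) : ℝ) = 0 := by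
    intro n
    apply truncatedTerm_of_nonpos hs
    push_cast
    linarith [n.cast_nonneg (α := ℝ)]
  have hL := tsum_of_add_one_of_neg_add_one (f := fun n : ℤ ↦ truncatedTerm s t (n : ℝ))
    (by simpa only [hterm] using (hasSum_polylogExp s ht).summable)
    (by simpa only [hneg] using summable_zero)
  simp only [hterm, hneg, tsum_zero, add_zero, Int.cast_zero,
    truncatedTerm_of_nonpos hs t le_rfl] at hL
  have hR := tsum_of_add_one_of_neg_add_one (f := fun k : ℤ ↦ latticePoint t (k : ℝ) ^ (s - 1))
    hs1 hs2
  -- The zero frequency contributes `Γ(1-s) t^(s-1)`, exactly the part removed in `polylogReg`.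
  have h0 : latticePoint t ((0 : ℤ) : ℝ) = t := by simp [latticePoint]
  rw [polylogReg, polylogExp, ← hL, hP, hR, h0]
  have hadd := Summable.tsum_add hs1 hs2
  simp only [Function.comp_def] at hadd
  push_cast at hadd ⊢
  rw [hadd]
  ring

/-! ### The regularised polylogarithm near `t = 0`. -/

lemma norm_latticePoint_pair_le {s : ℂ} (hs : s.re ≤ 1) (t : ℝ) (n : ℕ) :
    ‖latticePoint t (n + 1) ^ (s - 1) + latticePoint t (-(n + 1)) ^ (s - 1)‖ ≤
      2 * Real.exp (Real.pi * |s.im|) * ((n : ℝ) + 1) ^ (s.re - 1) := by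
  have hn : (0 : ℝ) < (n : ℝ) + 1 := by positivity
  have h1 := norm_latticePoint_cpow_le (w := s - 1) (by simpa using hs) t hn.ne'
  have h2 := norm_latticePoint_cpow_le (w := s - 1) (by simpa using hs) t (neg_ne_zero.mpr hn.ne')
  rw [abs_neg] at h2
  rw [abs_of_pos hn] at h1 h2
  simp only [Complex.sub_re, Complex.one_re, Complex.sub_im, Complex.one_im, sub_zero] at h1 h2
  refine (norm_add_le_of_le h1 h2).trans (le_of_eq (by ring))

lemma summable_nat_add_one_rpow {c : ℝ} (hc : c < -1) :
    Summable fun n : ℕ ↦ ((n : ℝ) + 1) ^ c := by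
  have := (summable_nat_add_iff 1).mpr (Real.summable_nat_rpow.mpr hc)
  simpa using this

lemma analyticAt_Gamma_one_sub {s : ℂ} (hs : s.re < 1) :
    AnalyticAt ℂ (fun s ↦ Complex.Gamma (1 - s)) s := by
  have hU : IsOpen {s : ℂ | s.re < 1} := isOpen_lt Complex.continuous_re continuous_const
  refine DifferentiableOn.analyticAt (s := {s : ℂ | s.re < 1}) (fun z hz ↦ ?_) (hU.mem_nhds hs)
  have hz' : z.re < 1 := hz
  refine DifferentiableAt.differentiableWithinAt ?_
  refine DifferentiableAt.comp z (Complex.differentiableAt_Gamma _ fun m h ↦ ?_) (by fun_prop)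
  have := congrArg Complex.re h
  simp at this
  linarith [m.cast_nonneg (α := ℝ)]

lemma exists_eventually_norm_polylogReg_le {s₀ : ℂ} (hs₀ : s₀.re < 0) :
    ∃ C : ℝ, ∀ᶠ s in 𝓝 s₀, ∀ t : ℝ, 0 < t → ‖polylogReg s t‖ ≤ C := by
  have hS := summable_nat_add_one_rpow (c := s₀.re / 2 - 1) (by linarith)
  refine ⟨(‖Complex.Gamma (1 - s₀)‖ + 1) * (2 * Real.exp (Real.pi * (|s₀.im| + 1)) *
    ∑' n : ℕ, ((n : ℝ) + 1) ^ (s₀.re / 2 - 1)), ?_⟩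
  have e1 : ∀ᶠ s : ℂ in 𝓝 s₀, s.re < s₀.re / 2 :=
    Complex.continuous_re.continuousAt.eventually_lt_const (by linarith)
  have e2 : ∀ᶠ s : ℂ in 𝓝 s₀, |s.im| < |s₀.im| + 1 :=
    (Complex.continuous_im.abs.continuousAt).eventually_lt_const (by linarith)
  have e3 : ∀ᶠ s : ℂ in 𝓝 s₀, ‖Complex.Gamma (1 - s)‖ < ‖Complex.Gamma (1 - s₀)‖ + 1 :=
    ((analyticAt_Gamma_one_sub (by linarith)).continuousAt.norm).eventually_lt_const
      (by linarith)
  filter_upwards [e1, e2, e3] with s h1 h2 h3 t ht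
  rw [polylogReg_eq_tsum (by linarith) ht, norm_mul]
  gcongr
  refine tsum_of_norm_bounded (hS.hasSum.mul_left _) fun n ↦ ?_
  refine (norm_latticePoint_pair_le (by linarith) t n).trans ?_
  gcongr
  linarith [n.cast_nonneg (α := ℝ)]

/-- The pair `±2πiy` produces the cosine of the functional equation of `ζ`. -/
lemma latticePoint_zero_cpow {y : ℝ} (hy : 0 < y) (w : ℂ) :
    latticePoint 0 y ^ w + latticePoint 0 (-y) ^ w =
      (2 * Real.pi) ^ w * (2 * Complex.cos (Real.pi * w / 2)) * (y : ℂ) ^ w := by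
  have hpi : (0 : ℝ) < 2 * Real.pi := by positivity
  have hy2 : (0 : ℝ) < 2 * Real.pi * y := by positivity
  have h1 : latticePoint 0 y = ((2 * Real.pi * y : ℝ) : ℂ) * Complex.I := by
    simp [latticePoint]
  have h2 : latticePoint 0 (-y) = ((2 * Real.pi * y : ℝ) : ℂ) * (-Complex.I) := by
    simp [latticePoint]
  have hI : Complex.I ≠ 0 := Complex.I_ne_zero
  have hI' : -Complex.I ≠ 0 := neg_ne_zero.mpr hI
  have hne : ((2 * Real.pi * y : ℝ) : ℂ) ≠ 0 := Complex.ofReal_ne_zero.mpr hy2.ne'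
  have h3 : ((2 * Real.pi * y : ℝ) : ℂ) ^ w = (2 * Real.pi) ^ w * (y : ℂ) ^ w := by
    rw [Complex.ofReal_mul, Complex.mul_cpow_ofReal_nonneg hpi.le hy.le]
    push_cast
    rfl
  have h4 : ∀ z : ℂ, z ≠ 0 → (((2 * Real.pi * y : ℝ) : ℂ) * z) ^ w =
      ((2 * Real.pi * y : ℝ) : ℂ) ^ w * z ^ w := by
    intro z hz
    rw [Complex.cpow_def_of_ne_zero (mul_ne_zero hne hz), Complex.cpow_def_of_ne_zero hne,
      Complex.cpow_def_of_ne_zero hz, Complex.log_ofReal_mul hy2 hz, Complex.ofReal_log hy2.le,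
      ← Complex.exp_add, add_mul]
  have h5 : Complex.I ^ w + (-Complex.I) ^ w = 2 * Complex.cos (Real.pi * w / 2) := by
    rw [Complex.cpow_def_of_ne_zero hI, Complex.cpow_def_of_ne_zero hI', Complex.log_I,
      Complex.log_neg_I, Complex.two_cos]
    congr 2 <;> ring
  rw [h1, h2, h4 _ hI, h4 _ hI', ← mul_add, h5, h3]
  ring

lemma tendsto_latticePoint_cpow {y : ℝ} (hy : y ≠ 0) (w : ℂ) :
    Tendsto (fun t : ℝ ↦ latticePoint t y ^ w) (𝓝[>] 0) (𝓝 (latticePoint 0 y ^ w)) := by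
  have hc : Continuous fun t : ℝ ↦ latticePoint t y := by
    unfold latticePoint
    fun_prop
  have h1 : ContinuousAt (fun t : ℝ ↦ latticePoint t y ^ w) 0 := by
    refine ContinuousAt.cpow hc.continuousAt continuousAt_const (Or.inr ?_)
    rw [latticePoint_im]
    exact mul_ne_zero (by positivity) hy
  exact h1.tendsto.mono_left nhdsWithin_le_nhds

/-- At `t = 0` Lipschitz's sum becomes the right-hand side of the functional equation. -/
lemma tendsto_polylogReg_of_re_neg {s : ℂ} (hs : s.re < 0) :
    Tendsto (polylogReg s) (𝓝[>] 0) (𝓝 (riemannZeta s)) := by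
  have hzeta : riemannZeta s = Complex.Gamma (1 - s) * ∑' n : ℕ,
      (latticePoint 0 (n + 1) ^ (s - 1) + latticePoint 0 (-(n + 1)) ^ (s - 1)) := by
    have h1 : 1 < (1 - s).re := by rw [Complex.sub_re, Complex.one_re]; linarith
    have h := riemannZeta_one_sub (s := 1 - s) (fun n hn ↦ ?_) (fun hn ↦ ?_)
    · rw [sub_sub_cancel] at h
      have hterm : ∀ n : ℕ,
          latticePoint 0 (n + 1) ^ (s - 1) + latticePoint 0 (-(n + 1)) ^ (s - 1) =
            (2 * Real.pi) ^ (s - 1) * (2 * Complex.cos (Real.pi * (s - 1) / 2)) *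
              (1 / ((n : ℂ) + 1) ^ (1 - s)) := by
        intro n
        rw [latticePoint_zero_cpow (by positivity), one_div, ← Complex.cpow_neg, neg_sub]
        push_cast
        rfl
      rw [h, zeta_eq_tsum_one_div_nat_add_one_cpow h1, tsum_congr hterm, tsum_mul_left, neg_sub,
        ← Complex.cos_neg]
      ring_nf
    · rw [hn] at h1
      simp at h1
      linarith [n.cast_nonneg (α := ℝ)]
    · rw [hn] at h1
      simp at h1
  rw [hzeta]
  have hT : Tendsto (fun t : ℝ ↦ ∑' n : ℕ,
      (latticePoint t (n + 1) ^ (s - 1) + latticePoint t (-(n + 1)) ^ (s - 1))) (𝓝[>] 0)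
      (𝓝 (∑' n : ℕ,
      (latticePoint 0 (n + 1) ^ (s - 1) + latticePoint 0 (-(n + 1)) ^ (s - 1)))) := by
    refine tendsto_tsum_of_dominated_convergence
      ((summable_nat_add_one_rpow (c := s.re - 1) (by linarith)).mul_left
        (2 * Real.exp (Real.pi * |s.im|))) (fun n ↦ ?_)
      (Eventually.of_forall fun t n ↦ norm_latticePoint_pair_le (by linarith) t n)
    have hn : ((n : ℝ) + 1) ≠ 0 := by positivity
    exact (tendsto_latticePoint_cpow hn _).add
      (tendsto_latticePoint_cpow (neg_ne_zero.mpr hn) _)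
  refine (hT.const_mul _).congr' ?_
  filter_upwards [self_mem_nhdsWithin] with t ht
  rw [polylogReg_eq_tsum hs ht]

lemma hasDerivAt_polylogReg {s : ℂ} (hs : s.re < 1) {t : ℝ} (ht : 0 < t) :
    HasDerivAt (polylogReg s) (-polylogReg (s - 1) t) t := by
  have hne : 1 - s ≠ 0 := by
    intro h
    rw [← sub_eq_zero.mp h] at hs
    simp at hs
  have ht' : (t : ℂ) ≠ 0 := Complex.ofReal_ne_zero.mpr ht.ne'
  have h1 : HasDerivAt (fun t : ℝ ↦ (t : ℂ) ^ (s - 1)) ((s - 1) * (t : ℂ) ^ (s - 1 - 1)) t := by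
    have := (hasDerivAt_id (t : ℂ)).cpow_const (c := s - 1) (Or.inl (by simpa using ht))
    simpa using! this.comp_ofReal
  convert! (hasDerivAt_polylogExp s ht).sub (h1.const_mul (Complex.Gamma (1 - s))) using 1
  rw [polylogReg, show 1 - (s - 1) = 1 - s + 1 by ring, Complex.Gamma_add_one _ hne]
  ring

lemma analyticAt_polylogReg {s : ℂ} (hs : s.re < 1) {t : ℝ} (ht : 0 < t) :
    AnalyticAt ℂ (fun s ↦ polylogReg s t) s := by
  refine ((differentiable_polylogExp ht).analyticAt s).sub ((analyticAt_Gamma_one_sub hs).mul ?_)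
  have ht' : (t : ℂ) ≠ 0 := Complex.ofReal_ne_zero.mpr ht.ne'
  refine Differentiable.analyticAt (fun z ↦ ?_) s
  exact DifferentiableAt.const_cpow (by fun_prop) (Or.inl ht')

lemma continuousOn_polylogReg {s : ℂ} : ContinuousOn (polylogReg s) (Ioi 0) :=
  (continuousOn_polylogExp s).sub (continuousOn_const.mul (continuousOn_ofReal_cpow _))

lemma analyticAt_integral_polylogReg {s₀ : ℂ} (hs₀ : s₀.re < 0) :
    AnalyticAt ℂ (fun s ↦ ∫ t in Ioc (0 : ℝ) 1, polylogReg s t) s₀ := by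
  obtain ⟨C, hC⟩ := exists_eventually_norm_polylogReg_le hs₀
  have e1 : ∀ᶠ s : ℂ in 𝓝 s₀, s.re < 1 :=
    Complex.continuous_re.continuousAt.eventually_lt_const (by linarith)
  obtain ⟨ε, hε, hball⟩ := Metric.eventually_nhds_iff_ball.mp (hC.and e1)
  refine analyticAt_integral hε (g := fun _ ↦ C) (integrable_const _) (fun s _ ↦ ?_) ?_ ?_
  · exact (continuousOn_polylogReg.mono Ioc_subset_Ioi_self).aestronglyMeasurable measurableSet_Ioc
  · refine (ae_restrict_iff' measurableSet_Ioc).mpr (ae_of_all _ fun t ht s hs ↦ ?_)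
    exact (analyticAt_polylogReg (hball s hs).2 ht.1).differentiableAt.differentiableWithinAt
  · exact (ae_restrict_iff' measurableSet_Ioc).mpr
      (ae_of_all _ fun t ht s hs ↦ (hball s hs).1 t ht.1)

/-- The bound from Lipschitz's sum needs negative real part, which `s - 1` has. Integrating the
derivative from `t` to `1` then gives a limit in a form visibly analytic in `s`. -/
lemma tendsto_polylogReg_integral {s : ℂ} (hs : s.re < 1) :
    Tendsto (polylogReg s) (𝓝[>] 0)
      (𝓝 (polylogReg s 1 + ∫ t in Ioc (0 : ℝ) 1, polylogReg (s - 1) t)) := by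
  obtain ⟨C, hC⟩ := exists_eventually_norm_polylogReg_le (s₀ := s - 1)
    (by rw [Complex.sub_re, Complex.one_re]; linarith)
  have hC' := hC.self_of_nhds
  have hint : ∀ b : ℝ, IntegrableOn (polylogReg (s - 1)) (Ioc 0 b) := fun b ↦ by
    exact (integrable_const C).mono'
      ((continuousOn_polylogReg.mono Ioc_subset_Ioi_self).aestronglyMeasurable measurableSet_Ioc)
      ((ae_restrict_iff' measurableSet_Ioc).mpr (ae_of_all _ fun t ht ↦ hC' t ht.1))
  have hval : ∀ t : ℝ, 0 < t → t ≤ 1 → polylogReg s t = polylogReg s 1 +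
      (∫ u in Ioc (0 : ℝ) 1, polylogReg (s - 1) u) -
        ∫ u in Ioc (0 : ℝ) t, polylogReg (s - 1) u := by
    intro t ht ht1
    have hI1 := (intervalIntegrable_iff_integrableOn_Ioc_of_le ht.le).mpr (hint t)
    have hI2 : IntervalIntegrable (polylogReg (s - 1)) volume t 1 :=
      (intervalIntegrable_iff_integrableOn_Ioc_of_le ht1).mpr
        ((hint 1).mono_set (Ioc_subset_Ioc_left ht.le))
    have hF := intervalIntegral.integral_eq_sub_of_hasDerivAt (f := fun u ↦ -polylogReg s u)
      (f' := polylogReg (s - 1)) (fun u hu ↦ by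
        rw [uIcc_of_le ht1] at hu
        simpa using (hasDerivAt_polylogReg hs (ht.trans_le hu.1)).fun_neg) hI2
    have hadd := intervalIntegral.integral_add_adjacent_intervals hI1 hI2
    rw [hF, intervalIntegral.integral_of_le ht.le, intervalIntegral.integral_of_le zero_le_one]
      at hadd
    rw [← hadd]
    ring
  have h0 : Tendsto (fun t : ℝ ↦ ∫ u in Ioc (0 : ℝ) t, polylogReg (s - 1) u) (𝓝[>] 0) (𝓝 0) := by
    refine squeeze_zero_norm' (a := fun t ↦ C * t) ?_ ?_
    · filter_upwards [self_mem_nhdsWithin] with t ht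
      have ht' : 0 < t := ht
      have := norm_setIntegral_le_of_norm_le_const (μ := volume) (s := Ioc 0 t) (by simp)
        (fun u hu ↦ hC' u hu.1)
      simpa [Measure.real, ht'.le] using this
    · have : Tendsto (fun t : ℝ ↦ C * t) (𝓝 0) (𝓝 (C * 0)) := tendsto_id.const_mul C
      rw [mul_zero] at this
      exact this.mono_left nhdsWithin_le_nhds
  have := (tendsto_const_nhds (x := polylogReg s 1 +
      ∫ u in Ioc (0 : ℝ) 1, polylogReg (s - 1) u)).sub h0
  rw [sub_zero] at this
  refine this.congr' ?_
  filter_upwards [Ioc_mem_nhdsGT zero_lt_one] with t ht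
  rw [hval t ht.1 ht.2]

lemma analyticAt_riemannZeta {s : ℂ} (hs : s ≠ 1) : AnalyticAt ℂ riemannZeta s := by
  refine DifferentiableOn.analyticAt (s := {1}ᶜ) (fun z hz ↦ ?_) (isOpen_compl_singleton.mem_nhds hs)
  exact (differentiableAt_riemannZeta hz).differentiableWithinAt

lemma ne_one_of_re_lt {s : ℂ} (hs : s.re < 1) : s ≠ 1 := by
  rintro rfl
  simp at hs

/-- The limit is analytic on `Re s < 1` and equals `ζ` near `-1`, hence throughout. -/
lemma tendsto_polylogReg {s : ℂ} (hs : s.re < 1) :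
    Tendsto (polylogReg s) (𝓝[>] 0) (𝓝 (riemannZeta s)) := by
  have hU : AnalyticOnNhd ℂ
      (fun s ↦ polylogReg s 1 + ∫ t in Ioc (0 : ℝ) 1, polylogReg (s - 1) t) {s | s.re < 1} := by
    intro z hz
    have hz' : z.re < 1 := hz
    refine (analyticAt_polylogReg hz' zero_lt_one).add ?_
    exact (analyticAt_integral_polylogReg (s₀ := z - 1)
      (by rw [Complex.sub_re, Complex.one_re]; linarith)).comp_of_eq
        (f := fun z ↦ z - 1) (analyticAt_id.sub analyticAt_const) rfl
  have hZ : AnalyticOnNhd ℂ riemannZeta {s | s.re < 1} := fun z hz ↦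
    analyticAt_riemannZeta (ne_one_of_re_lt hz)
  have hEq := hU.eqOn_of_preconnected_of_eventuallyEq hZ (convex_halfSpace_re_lt 1).isPreconnected
    (z₀ := -1) (by simp) ?_
  · rw [← hEq hs]
    exact tendsto_polylogReg_integral hs
  · have e1 : ∀ᶠ s : ℂ in 𝓝 (-1), s.re < 0 :=
      Complex.continuous_re.continuousAt.eventually_lt_const (by simp)
    filter_upwards [e1] with z hz
    exact tendsto_nhds_unique (tendsto_polylogReg_integral (by linarith))
      (tendsto_polylogReg_of_re_neg hz)

/-! ### Taylor expansion of the regularised polylogarithm. -/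

/-- The Taylor coefficients at `t = 0` of `polylogReg s`. -/
noncomputable def polylogCoeff (k : ℕ) (s : ℂ) : ℂ := (-1) ^ k * riemannZeta (s - k) / k.factorial

noncomputable def polylogPoly (N : ℕ) (s : ℂ) (t : ℝ) : ℂ :=
  ∑ k ∈ Finset.range N, polylogCoeff k s * (t : ℂ) ^ k

noncomputable def polylogRem (N : ℕ) (s : ℂ) (t : ℝ) : ℂ := polylogReg s t - polylogPoly N s t

/-- The coefficients satisfy `(k+1) c_{k+1}(s) = -c_k(s-1)`, matching the differential relation of
`polylogReg`. -/
lemma hasDerivAt_polylogPoly (N : ℕ) (s : ℂ) (t : ℝ) :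
    HasDerivAt (polylogPoly (N + 1) s) (-polylogPoly N (s - 1) t) t := by
  have h : HasDerivAt (fun t : ℝ ↦ ∑ k ∈ Finset.range N, polylogCoeff (k + 1) s * (t : ℂ) ^ (k + 1) +
      polylogCoeff 0 s * (t : ℂ) ^ 0)
      (∑ k ∈ Finset.range N, polylogCoeff (k + 1) s * (((k : ℂ) + 1) * (t : ℂ) ^ k)) t := by
    simp only [pow_zero]
    refine HasDerivAt.add_const _ (HasDerivAt.fun_sum fun k _ ↦ HasDerivAt.const_mul _ ?_)
    have := (hasDerivAt_pow (k + 1) (t : ℂ)).comp_ofReal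
    simpa using this
  convert! h using 1
  · funext t
    rw [polylogPoly, Finset.sum_range_succ']
  · rw [polylogPoly, ← Finset.sum_neg_distrib]
    refine Finset.sum_congr rfl fun k _ ↦ ?_
    have : (k : ℂ) + 1 ≠ 0 := Nat.cast_add_one_ne_zero k
    have : (k.factorial : ℂ) ≠ 0 := Nat.cast_ne_zero.mpr k.factorial_ne_zero
    rw [polylogCoeff, polylogCoeff, Nat.factorial_succ]
    push_cast
    rw [show s - ((k : ℂ) + 1) = s - 1 - k by ring]
    field_simp
    ring

lemma hasDerivAt_polylogRem (N : ℕ) {s : ℂ} (hs : s.re < 1) {t : ℝ} (ht : 0 < t) :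
    HasDerivAt (polylogRem (N + 1) s) (-polylogRem N (s - 1) t) t := by
  convert! (hasDerivAt_polylogReg hs ht).sub (hasDerivAt_polylogPoly N s t) using 1
  rw [polylogRem]
  ring

lemma tendsto_polylogRem (N : ℕ) {s : ℂ} (hs : s.re < 1) :
    Tendsto (polylogRem (N + 1) s) (𝓝[>] 0) (𝓝 0) := by
  have h1 := (hasDerivAt_polylogPoly N s 0).continuousAt.tendsto
  have h2 : polylogPoly (N + 1) s 0 = riemannZeta s := by
    rw [polylogPoly, Finset.sum_range_succ']
    simp [polylogCoeff]
  rw [h2] at h1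
  simpa using! (tendsto_polylogReg hs).sub (h1.mono_left nhdsWithin_le_nhds)

/-- Taylor's formula for `polylogReg` at `t = 0`, uniformly for `t > 0` and locally uniformly
in `s`. -/
lemma exists_eventually_norm_polylogRem_le (N : ℕ) {s₀ : ℂ} (h1 : s₀.re < 1) (h2 : s₀.re < N) :
    ∃ C : ℝ, 0 ≤ C ∧ ∀ᶠ s in 𝓝 s₀, ∀ t : ℝ, 0 < t → ‖polylogRem N s t‖ ≤ C * t ^ N := by
  -- Passing from `N` to `N + 1` integrates the bound at `s - 1`; the hypothesis `s₀.re < N` ensures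
  -- that the descent ends in `Re s < 0`, where `polylogReg` is bounded.
  induction N generalizing s₀ with
  | zero =>
    obtain ⟨C, hC⟩ := exists_eventually_norm_polylogReg_le (s₀ := s₀) (by simpa using h2)
    refine ⟨max C 0, le_max_right _ _, ?_⟩
    filter_upwards [hC] with s hs t ht
    simpa [polylogRem, polylogPoly] using Or.inl (hs t ht)
  | succ N ih =>
    push_cast at h2
    obtain ⟨C, hC0, hC⟩ := ih (s₀ := s₀ - 1) (by rw [Complex.sub_re, Complex.one_re]; linarith)
      (by rw [Complex.sub_re, Complex.one_re]; linarith)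
    refine ⟨C, hC0, ?_⟩
    have hcont : Tendsto (fun s : ℂ ↦ s - 1) (𝓝 s₀) (𝓝 (s₀ - 1)) :=
      tendsto_id.sub tendsto_const_nhds
    have e1 : ∀ᶠ s : ℂ in 𝓝 s₀, s.re < 1 :=
      Complex.continuous_re.continuousAt.eventually_lt_const h1
    filter_upwards [hcont.eventually hC, e1] with s hs hs1 t ht
    -- The derivative is available only for positive arguments, so the mean value inequality is used
    -- on `[δ, t]` and then `δ → 0`.
    have hstep : ∀ δ : ℝ, 0 < δ → δ ≤ t →
        ‖polylogRem (N + 1) s t - polylogRem (N + 1) s δ‖ ≤ C * t ^ N * (t - δ) := by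
      intro δ hδ hδt
      refine norm_image_sub_le_of_norm_deriv_le_segment' (f := polylogRem (N + 1) s)
        (f' := fun u ↦ -polylogRem N (s - 1) u) (fun u hu ↦ ?_) (fun u hu ↦ ?_) t
        (right_mem_Icc.mpr hδt)
      · exact (hasDerivAt_polylogRem N hs1 (hδ.trans_le hu.1)).hasDerivWithinAt
      · rw [norm_neg]
        refine (hs u (hδ.trans_le hu.1)).trans ?_
        have := hδ.trans_le hu.1
        have := hu.2.le
        gcongr
    have hl : Tendsto (fun δ ↦ ‖polylogRem (N + 1) s t - polylogRem (N + 1) s δ‖) (𝓝[>] 0)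
        (𝓝 ‖polylogRem (N + 1) s t - 0‖) :=
      (tendsto_const_nhds.sub (tendsto_polylogRem N hs1)).norm
    have hr : Tendsto (fun δ : ℝ ↦ C * t ^ N * (t - δ)) (𝓝[>] 0) (𝓝 (C * t ^ N * (t - 0))) :=
      ((tendsto_const_nhds.sub tendsto_id).const_mul _).mono_left nhdsWithin_le_nhds
    rw [sub_zero] at hl hr
    rw [pow_succ, ← mul_assoc]
    refine le_of_tendsto_of_tendsto hl hr ?_
    filter_upwards [Ioc_mem_nhdsGT ht] with δ hδ using hstep δ hδ.1 hδ.2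

/-! ### The Mellin integrand and its splitting at `t = 1`. -/

noncomputable def thetaIntegrand (x : ℝ) (s : ℂ) (t : ℝ) : ℂ :=
  (t : ℂ) ^ (s - 1) * (polylogExp s t * polylogExp s (x * t))

/-- The contribution of the Taylor remainders to `thetaIntegrand` near `t = 0`. -/
noncomputable def thetaIntegrandRem (x : ℝ) (N : ℕ) (s : ℂ) (t : ℝ) : ℂ :=
  (t : ℂ) ^ (s - 1) * (polylogExp s t * polylogRem N s (x * t) +
    polylogRem N s t * polylogExp s (x * t) - polylogRem N s t * polylogRem N s (x * t))

noncomputable def thetaIntegrandMain (x : ℝ) (N : ℕ) (s : ℂ) (t : ℝ) : ℂ :=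
  (t : ℂ) ^ (s - 1) * ((Complex.Gamma (1 - s) * (t : ℂ) ^ (s - 1) + polylogPoly N s t) *
    (Complex.Gamma (1 - s) * ((x * t : ℝ) : ℂ) ^ (s - 1) + polylogPoly N s (x * t)))

/-- With `a`, `b` the remainders of `A`, `B`, this is `AB = (A-a)(B-b) + (Ab + aB - ab)`. -/
lemma thetaIntegrand_eq (x : ℝ) (N : ℕ) (s : ℂ) (t : ℝ) :
    thetaIntegrand x s t = thetaIntegrandMain x N s t + thetaIntegrandRem x N s t := by
  simp only [thetaIntegrand, thetaIntegrandMain, thetaIntegrandRem, polylogRem, polylogReg]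
  ring

lemma mapsTo_const_mul_Ioi {x : ℝ} (hx : 0 < x) : MapsTo (fun t ↦ x * t) (Ioi 0) (Ioi 0) :=
  fun _ ht ↦ mul_pos hx ht

lemma continuousOn_thetaIntegrand {x : ℝ} (hx : 0 < x) (s : ℂ) :
    ContinuousOn (thetaIntegrand x s) (Ioi 0) :=
  (continuousOn_ofReal_cpow _).mul ((continuousOn_polylogExp s).mul
    ((continuousOn_polylogExp s).comp (by fun_prop) (mapsTo_const_mul_Ioi hx)))

lemma continuous_polylogPoly (N : ℕ) (s : ℂ) : Continuous (polylogPoly N s) := by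
  unfold polylogPoly
  fun_prop

lemma continuousOn_polylogRem (N : ℕ) (s : ℂ) : ContinuousOn (polylogRem N s) (Ioi 0) :=
  continuousOn_polylogReg.sub (continuous_polylogPoly N s).continuousOn

lemma continuousOn_thetaIntegrandRem {x : ℝ} (hx : 0 < x) (N : ℕ) (s : ℂ) :
    ContinuousOn (thetaIntegrandRem x N s) (Ioi 0) := by
  have h1 := (continuousOn_polylogExp s).comp (by fun_prop) (mapsTo_const_mul_Ioi hx)
  have h2 := (continuousOn_polylogRem N s).comp (by fun_prop) (mapsTo_const_mul_Ioi hx)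
  exact (continuousOn_ofReal_cpow _).mul ((((continuousOn_polylogExp s).mul h2).add
    ((continuousOn_polylogRem N s).mul h1)).sub ((continuousOn_polylogRem N s).mul h2))

lemma analyticAt_ofReal_cpow {t : ℝ} (ht : 0 < t) (s : ℂ) :
    AnalyticAt ℂ (fun s : ℂ ↦ (t : ℂ) ^ (s - 1)) s := by
  have ht' : (t : ℂ) ≠ 0 := Complex.ofReal_ne_zero.mpr ht.ne'
  exact Differentiable.analyticAt (fun z ↦
    DifferentiableAt.const_cpow (by fun_prop) (Or.inl ht')) s

lemma analyticAt_polylogCoeff (k : ℕ) {s : ℂ} (hs : s.re < 1) :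
    AnalyticAt ℂ (polylogCoeff k) s := by
  have h : AnalyticAt ℂ (fun s : ℂ ↦ riemannZeta (s - k)) s :=
    (analyticAt_riemannZeta (s := s - k) (ne_one_of_re_lt (by
      rw [Complex.sub_re, Complex.natCast_re]; linarith [k.cast_nonneg (α := ℝ)]))).comp_of_eq
      (f := fun s : ℂ ↦ s - k) (analyticAt_id.sub analyticAt_const) rfl
  exact (analyticAt_const.mul h).div_const

lemma analyticAt_polylogRem (N : ℕ) {s : ℂ} (hs : s.re < 1) {t : ℝ} (ht : 0 < t) :
    AnalyticAt ℂ (fun s ↦ polylogRem N s t) s :=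
  (analyticAt_polylogReg hs ht).sub (Finset.analyticAt_fun_sum _ fun k _ ↦
    (analyticAt_polylogCoeff k hs).mul analyticAt_const)

lemma analyticAt_thetaIntegrandRem {x : ℝ} (hx : 0 < x) (N : ℕ) {s : ℂ} (hs : s.re < 1) {t : ℝ}
    (ht : 0 < t) : AnalyticAt ℂ (fun s ↦ thetaIntegrandRem x N s t) s := by
  have hxt := mul_pos hx ht
  have h1 := (differentiable_polylogExp ht).analyticAt s
  have h2 := (differentiable_polylogExp hxt).analyticAt s
  have h3 := analyticAt_polylogRem N hs ht
  have h4 := analyticAt_polylogRem N hs hxt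
  exact (analyticAt_ofReal_cpow ht s).mul (((h1.mul h4).add (h3.mul h2)).sub (h3.mul h4))

/-- A dominating function for `thetaIntegrand` on `(1, ∞)`, locally uniform in `s`. -/
lemma exists_norm_thetaIntegrand_le {x : ℝ} (hx : 0 < x) (s₀ : ℂ) :
    ∃ g : ℝ → ℝ, IntegrableOn g (Ioi 1) ∧
      ∀ s ∈ Metric.ball s₀ 1, ∀ t ∈ Ioi (1 : ℝ), ‖thetaIntegrand x s t‖ ≤ g t := by
  obtain ⟨C, hC0, hC⟩ := exists_norm_polylogExp_le (s₀.re - 1) zero_lt_one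
  obtain ⟨D, hD0, hD⟩ := exists_norm_polylogExp_le (s₀.re - 1) hx
  -- For `t > 1` and `s` in the unit ball, `Re s - 1 < |Re s₀|`. The absolute value keeps the power
  -- integrable at `0`; the decay of one polylogarithm suffices.
  refine ⟨fun t ↦ C * D * (t ^ |s₀.re| * Real.exp (-(1 / 2 * t))),
    ((integrableOn_rpow_mul_exp_neg (by linarith [abs_nonneg s₀.re])
      one_half_pos).mono_set (Ioi_subset_Ioi zero_le_one)).const_mul _, fun s hs t ht ↦ ?_⟩
  have ht1 : 1 < t := ht
  have ht0 : 0 < t := by linarith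
  have hre := (Complex.abs_re_le_norm (s - s₀)).trans (mem_ball_iff_norm.mp hs).le
  rw [abs_le, Complex.sub_re] at hre
  have h1 := hC s (by linarith [hre.1]) t ht1.le
  have h2 := hD s (by linarith [hre.1]) (x * t) (by nlinarith)
  have h3 : D * Real.exp (-(x * t / 2)) ≤ D := by
    refine mul_le_of_le_one_right hD0 (Real.exp_le_one_iff.mpr ?_)
    have := mul_pos hx ht0
    linarith
  have h4 : t ^ (s - 1).re ≤ t ^ |s₀.re| := by
    refine Real.rpow_le_rpow_of_exponent_le ht1.le ?_
    rw [Complex.sub_re, Complex.one_re]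
    linarith [hre.2, le_abs_self s₀.re]
  rw [thetaIntegrand, norm_mul, norm_mul, Complex.norm_cpow_eq_rpow_re_of_pos ht0]
  calc _ ≤ t ^ |s₀.re| * ((C * Real.exp (-(t / 2))) * D) := by
        gcongr
        exact h2.trans h3
    _ = _ := by ring_nf

lemma integrableOn_thetaIntegrand_Ioi_one {x : ℝ} (hx : 0 < x) (s : ℂ) :
    IntegrableOn (thetaIntegrand x s) (Ioi 1) := by
  obtain ⟨g, hg, hle⟩ := exists_norm_thetaIntegrand_le hx s
  exact hg.mono' (((continuousOn_thetaIntegrand hx s).mono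
    (Ioi_subset_Ioi zero_le_one)).aestronglyMeasurable measurableSet_Ioi)
    ((ae_restrict_iff' measurableSet_Ioi).mpr (ae_of_all _
      (hle s (Metric.mem_ball_self zero_lt_one))))

lemma analyticAt_integral_thetaIntegrand {x : ℝ} (hx : 0 < x) (s₀ : ℂ) :
    AnalyticAt ℂ (fun s ↦ ∫ t in Ioi (1 : ℝ), thetaIntegrand x s t) s₀ := by
  obtain ⟨g, hg, hle⟩ := exists_norm_thetaIntegrand_le hx s₀
  refine analyticAt_integral zero_lt_one hg (fun s _ ↦ ?_) ?_ ?_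
  · exact ((continuousOn_thetaIntegrand hx s).mono
      (Ioi_subset_Ioi zero_le_one)).aestronglyMeasurable measurableSet_Ioi
  · refine (ae_restrict_iff' measurableSet_Ioi).mpr (ae_of_all _ fun t ht s _ ↦ ?_)
    have ht0 : 0 < t := zero_lt_one.trans ht
    exact ((analyticAt_ofReal_cpow ht0 s).differentiableAt.mul ((differentiable_polylogExp ht0 s).mul
      (differentiable_polylogExp (mul_pos hx ht0) s))).differentiableWithinAt
  · exact (ae_restrict_iff' measurableSet_Ioi).mpr (ae_of_all _ fun t ht s hs ↦ hle s hs t ht)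

/-- The three terms bound `Γ(1-s) t^(s-1)`, `ζ(s)` and the Taylor remainder of order one. -/
lemma exists_eventually_norm_polylogExp_le {s₀ : ℂ} (hs₀ : s₀.re < 1) :
    ∃ C : ℝ, 0 ≤ C ∧ ∀ᶠ s in 𝓝 s₀, ∀ t : ℝ, 0 < t →
      ‖polylogExp s t‖ ≤ C * (t ^ (s.re - 1) + 1 + t) := by
  obtain ⟨D, hD0, hD⟩ := exists_eventually_norm_polylogRem_le 1 hs₀ (by simpa using hs₀)
  have e1 : ∀ᶠ s : ℂ in 𝓝 s₀, ‖Complex.Gamma (1 - s)‖ < ‖Complex.Gamma (1 - s₀)‖ + 1 :=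
    ((analyticAt_Gamma_one_sub hs₀).continuousAt.norm).eventually_lt_const (by linarith)
  have e2 : ∀ᶠ s : ℂ in 𝓝 s₀, ‖riemannZeta s‖ < ‖riemannZeta s₀‖ + 1 :=
    ((analyticAt_riemannZeta (ne_one_of_re_lt hs₀)).continuousAt.norm).eventually_lt_const
      (by linarith)
  refine ⟨(‖Complex.Gamma (1 - s₀)‖ + 1) + (‖riemannZeta s₀‖ + 1) + D, by positivity, ?_⟩
  filter_upwards [hD, e1, e2] with s h1 h2 h3 t ht
  have hdec : polylogExp s t = Complex.Gamma (1 - s) * (t : ℂ) ^ (s - 1) + riemannZeta s +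
      polylogRem 1 s t := by
    simp [polylogRem, polylogReg, polylogPoly, polylogCoeff]
  have hn : ‖(t : ℂ) ^ (s - 1)‖ = t ^ (s.re - 1) := by
    rw [Complex.norm_cpow_eq_rpow_re_of_pos ht]
    simp
  have h4 := h1 t ht
  rw [pow_one] at h4
  have hp := Real.rpow_pos_of_pos ht (s.re - 1)
  rw [hdec]
  refine norm_add₃_le.trans ?_
  rw [norm_mul, hn]
  have h5 : ‖Complex.Gamma (1 - s)‖ * t ^ (s.re - 1) ≤
      (‖Complex.Gamma (1 - s₀)‖ + 1) * t ^ (s.re - 1) := by gcongr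
  have := norm_nonneg (Complex.Gamma (1 - s₀))
  have := norm_nonneg (riemannZeta s₀)
  nlinarith [mul_nonneg hD0 hp.le, mul_nonneg (norm_nonneg (Complex.Gamma (1 - s₀))) ht.le,
    mul_nonneg (norm_nonneg (riemannZeta s₀)) ht.le,
    mul_nonneg (norm_nonneg (riemannZeta s₀)) hp.le]

/-- With `T = t^(Re s - 1) ≥ 1`, the worst products have size `T² t^N = t^(N + 2 Re s - 2)`; this is
where the condition on `N` comes from. -/
lemma exists_eventually_norm_thetaIntegrandRem_le {x : ℝ} (hx : 0 < x) {N : ℕ} {s₀ : ℂ}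
    (h1 : s₀.re < 1) (h2 : 2 < N + 2 * s₀.re) :
    ∃ C : ℝ, ∀ᶠ s in 𝓝 s₀, ∀ t ∈ Ioc (0 : ℝ) 1, ‖thetaIntegrandRem x N s t‖ ≤ C := by
  have hN : (0 : ℝ) < N := by linarith
  have hN1 : (1 : ℝ) ≤ N := by exact_mod_cast hN
  obtain ⟨D, hD0, hD⟩ := exists_eventually_norm_polylogRem_le N h1 (by linarith)
  obtain ⟨A, hA0, hA⟩ := exists_eventually_norm_polylogExp_le h1
  have e1 : ∀ᶠ s : ℂ in 𝓝 s₀, s.re < 1 :=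
    Complex.continuous_re.continuousAt.eventually_lt_const h1
  have e2 : ∀ᶠ s : ℂ in 𝓝 s₀, 1 - (N : ℝ) / 2 < s.re :=
    Complex.continuous_re.continuousAt.eventually_const_lt (by linarith)
  have e3 : ∀ᶠ s : ℂ in 𝓝 s₀, x ^ (s.re - 1) < x ^ (s₀.re - 1) + 1 := by
    have : ContinuousAt (fun s : ℂ ↦ x ^ (s.re - 1)) s₀ :=
      ContinuousAt.rpow continuousAt_const (by fun_prop) (Or.inl hx.ne')
    exact this.eventually_lt_const (by linarith)
  set B := A * (x ^ (s₀.re - 1) + 1 + 1 + x) with hB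
  have hxp := Real.rpow_pos_of_pos hx (s₀.re - 1)
  have hB0 : 0 ≤ B := by positivity
  refine ⟨A * 3 * (D * x ^ N) + D * B + D * (D * x ^ N), ?_⟩
  filter_upwards [hD, hA, e1, e2, e3] with s hsD hsA hs1 hs2 hs3 t ht
  have ht0 := ht.1
  have hxt := mul_pos hx ht0
  set T := t ^ (s.re - 1) with hT
  have hT1 : 1 ≤ T := Real.one_le_rpow_of_pos_of_le_one_of_nonpos ht0 ht.2 (by linarith)
  have hT0 : 0 ≤ T := by linarith
  have b1 : ‖polylogRem N s t‖ ≤ D * t ^ N := hsD t ht0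
  have b2 : ‖polylogRem N s (x * t)‖ ≤ D * x ^ N * t ^ N := by
    have := hsD (x * t) hxt
    rwa [mul_pow, ← mul_assoc] at this
  have b3 : ‖polylogExp s t‖ ≤ A * 3 * T := by
    refine (hsA t ht0).trans ?_
    rw [mul_assoc]
    gcongr
    linarith [ht.2]
  have b4 : ‖polylogExp s (x * t)‖ ≤ B * T := by
    refine (hsA (x * t) hxt).trans ?_
    rw [hB, mul_assoc, Real.mul_rpow hx.le ht0.le]
    gcongr
    have : x * t ≤ x * T := by
      gcongr
      linarith [ht.2]
    have : x ^ (s.re - 1) * T ≤ (x ^ (s₀.re - 1) + 1) * T := by gcongr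
    nlinarith
  have hn : ‖(t : ℂ) ^ (s - 1)‖ = T := by
    rw [Complex.norm_cpow_eq_rpow_re_of_pos ht0]
    simp [hT]
  have hTT : T * T * t ^ N ≤ 1 := by
    rw [hT, ← Real.rpow_add ht0, ← Real.rpow_natCast, ← Real.rpow_add ht0]
    exact Real.rpow_le_one ht0.le ht.2 (by linarith)
  have htN : (0 : ℝ) ≤ t ^ N := by positivity
  have htN1 : t ^ N ≤ 1 := pow_le_one₀ ht0.le ht.2
  have hTT' : T * (t ^ N * t ^ N) ≤ 1 := by
    have : T * (t ^ N * t ^ N) ≤ T * (T * t ^ N * 1) := by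
      gcongr
      nlinarith
    linarith
  rw [thetaIntegrandRem, norm_mul, hn]
  calc T * ‖_‖ ≤ T * (A * 3 * T * (D * x ^ N * t ^ N) + D * t ^ N * (B * T) +
        D * t ^ N * (D * x ^ N * t ^ N)) := by
        gcongr
        refine (norm_sub_le _ _).trans (add_le_add ((norm_add_le _ _).trans (add_le_add ?_ ?_)) ?_)
        all_goals
          rw [norm_mul]
          gcongr
    _ = A * 3 * (D * x ^ N) * (T * T * t ^ N) + D * B * (T * T * t ^ N) +
        D * (D * x ^ N) * (T * (t ^ N * t ^ N)) := by ring
    _ ≤ A * 3 * (D * x ^ N) * 1 + D * B * 1 + D * (D * x ^ N) * 1 := by gcongr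
    _ = _ := by ring

lemma integrableOn_thetaIntegrandRem {x : ℝ} (hx : 0 < x) {N : ℕ} {s : ℂ}
    (h1 : s.re < 1) (h2 : 2 < N + 2 * s.re) :
    IntegrableOn (thetaIntegrandRem x N s) (Ioc 0 1) := by
  obtain ⟨C, hC⟩ := exists_eventually_norm_thetaIntegrandRem_le hx h1 h2
  exact (integrable_const C).mono' (((continuousOn_thetaIntegrandRem hx N s).mono
    Ioc_subset_Ioi_self).aestronglyMeasurable measurableSet_Ioc)
    ((ae_restrict_iff' measurableSet_Ioc).mpr (ae_of_all _ hC.self_of_nhds))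

lemma analyticAt_integral_thetaIntegrandRem {x : ℝ} (hx : 0 < x) {N : ℕ} {s₀ : ℂ}
    (h1 : s₀.re < 1) (h2 : 2 < N + 2 * s₀.re) :
    AnalyticAt ℂ (fun s ↦ ∫ t in Ioc (0 : ℝ) 1, thetaIntegrandRem x N s t) s₀ := by
  obtain ⟨C, hC⟩ := exists_eventually_norm_thetaIntegrandRem_le hx h1 h2
  have e1 : ∀ᶠ s : ℂ in 𝓝 s₀, s.re < 1 :=
    Complex.continuous_re.continuousAt.eventually_lt_const h1
  obtain ⟨ε, hε, hball⟩ := Metric.eventually_nhds_iff_ball.mp (hC.and e1)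
  refine analyticAt_integral hε (g := fun _ ↦ C) (integrable_const _) (fun s _ ↦ ?_) ?_ ?_
  · exact ((continuousOn_thetaIntegrandRem hx N s).mono
      Ioc_subset_Ioi_self).aestronglyMeasurable measurableSet_Ioc
  · refine (ae_restrict_iff' measurableSet_Ioc).mpr (ae_of_all _ fun t ht s hs ↦ ?_)
    exact (analyticAt_thetaIntegrandRem hx N
      (hball s hs).2 ht.1).differentiableAt.differentiableWithinAt
  · exact (ae_restrict_iff' measurableSet_Ioc).mpr
      (ae_of_all _ fun t ht s hs ↦ (hball s hs).1 t ht)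

/-! ### The explicit polar terms. -/

/-- Each fraction is `∫₀¹ t^(w-1) dt = 1/w` for one monomial of `thetaIntegrandMain`; the formula
keeps its meaning where the integral diverges. -/
noncomputable def thetaPolar (x : ℝ) (N : ℕ) (s : ℂ) : ℂ :=
  Complex.Gamma (1 - s) ^ 2 * (x : ℂ) ^ (s - 1) / (3 * s - 2) +
  ∑ k ∈ Finset.range N, Complex.Gamma (1 - s) * polylogCoeff k s * ((x : ℂ) ^ k + (x : ℂ) ^ (s - 1)) /
    (2 * s - 1 + k) +
  ∑ k ∈ Finset.range N, ∑ l ∈ Finset.range N,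
    polylogCoeff k s * polylogCoeff l s * (x : ℂ) ^ l / (s + k + l)

lemma integral_cpow_Ioc {w : ℂ} (hw : 0 < w.re) :
    IntegrableOn (fun t : ℝ ↦ (t : ℂ) ^ (w - 1)) (Ioc 0 1) ∧
      ∫ t in Ioc (0 : ℝ) 1, (t : ℂ) ^ (w - 1) = 1 / w := by
  have h1 : -1 < (w - 1).re := by rw [Complex.sub_re, Complex.one_re]; linarith
  have hw0 : w ≠ 0 := by
    rintro rfl
    simp at hw
  constructor
  · exact (intervalIntegrable_iff_integrableOn_Ioc_of_le zero_le_one).mp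
      (intervalIntegral.intervalIntegrable_cpow' h1)
  · rw [← intervalIntegral.integral_of_le zero_le_one, integral_cpow (Or.inl h1)]
    simp [Complex.zero_cpow hw0]

lemma thetaIntegrandMain_eq_sum {x : ℝ} (hx : 0 < x) (N : ℕ) (s : ℂ) {t : ℝ} (ht : 0 < t) :
    thetaIntegrandMain x N s t =
      Complex.Gamma (1 - s) ^ 2 * (x : ℂ) ^ (s - 1) * (t : ℂ) ^ (3 * s - 2 - 1) +
      ∑ k ∈ Finset.range N, Complex.Gamma (1 - s) * polylogCoeff k s *
        ((x : ℂ) ^ k + (x : ℂ) ^ (s - 1)) * (t : ℂ) ^ (2 * s - 1 + k - 1) +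
      ∑ k ∈ Finset.range N, ∑ l ∈ Finset.range N,
        polylogCoeff k s * polylogCoeff l s * (x : ℂ) ^ l * (t : ℂ) ^ (s + k + l - 1) := by
  have ht' : (t : ℂ) ≠ 0 := Complex.ofReal_ne_zero.mpr ht.ne'
  set T := (t : ℂ) ^ (s - 1) with hT
  have p1 : (t : ℂ) ^ (3 * s - 2 - 1) = T * T * T := by
    rw [hT, ← Complex.cpow_add _ _ ht', ← Complex.cpow_add _ _ ht']
    congr 1
    ring
  have p2 : ∀ k : ℕ, (t : ℂ) ^ (2 * s - 1 + k - 1) = T * T * (t : ℂ) ^ k := fun k ↦ by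
    rw [hT, ← Complex.cpow_natCast, ← Complex.cpow_add _ _ ht', ← Complex.cpow_add _ _ ht']
    congr 1
    ring
  have p3 : ∀ k l : ℕ, (t : ℂ) ^ (s + k + l - 1) = T * ((t : ℂ) ^ k * (t : ℂ) ^ l) := fun k l ↦ by
    rw [hT, ← Complex.cpow_natCast, ← Complex.cpow_natCast, ← Complex.cpow_add _ _ ht',
      ← Complex.cpow_add _ _ ht']
    congr 1
    ring
  have p4 : ((x * t : ℝ) : ℂ) ^ (s - 1) = (x : ℂ) ^ (s - 1) * T := by
    rw [Complex.ofReal_mul, Complex.mul_cpow_ofReal_nonneg hx.le ht.le]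
  have p5 : ∀ k : ℕ, ((x * t : ℝ) : ℂ) ^ k = (x : ℂ) ^ k * (t : ℂ) ^ k := fun k ↦ by
    rw [Complex.ofReal_mul, mul_pow]
  simp only [thetaIntegrandMain, polylogPoly, p1, p2, p3, p4, p5]
  have q : ∑ k ∈ Finset.range N, ∑ l ∈ Finset.range N,
      polylogCoeff k s * polylogCoeff l s * (x : ℂ) ^ l * (T * ((t : ℂ) ^ k * (t : ℂ) ^ l)) =
      T * ((∑ k ∈ Finset.range N, polylogCoeff k s * (t : ℂ) ^ k) *
        ∑ l ∈ Finset.range N, polylogCoeff l s * ((x : ℂ) ^ l * (t : ℂ) ^ l)) := by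
    rw [Finset.sum_mul_sum, Finset.mul_sum]
    refine Finset.sum_congr rfl fun k _ ↦ ?_
    rw [Finset.mul_sum]
    exact Finset.sum_congr rfl fun l _ ↦ by ring
  have q2 : ∑ k ∈ Finset.range N, Complex.Gamma (1 - s) * polylogCoeff k s *
        ((x : ℂ) ^ k + (x : ℂ) ^ (s - 1)) * (T * T * (t : ℂ) ^ k) =
      T * T * Complex.Gamma (1 - s) *
        ((∑ l ∈ Finset.range N, polylogCoeff l s * ((x : ℂ) ^ l * (t : ℂ) ^ l)) +
        (x : ℂ) ^ (s - 1) * ∑ k ∈ Finset.range N, polylogCoeff k s * (t : ℂ) ^ k) := by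
    rw [Finset.mul_sum, ← Finset.sum_add_distrib, Finset.mul_sum]
    exact Finset.sum_congr rfl fun l _ ↦ by ring
  rw [q, q2]
  ring

/-- The bound `2/3` is forced by the most singular monomial `t^(3s-3)`. -/
lemma integral_thetaIntegrandMain {x : ℝ} (hx : 0 < x) (N : ℕ) {s : ℂ} (hs : 2 / 3 < s.re) :
    IntegrableOn (thetaIntegrandMain x N s) (Ioc 0 1) ∧
      ∫ t in Ioc (0 : ℝ) 1, thetaIntegrandMain x N s t = thetaPolar x N s := by
  have i1 := integral_cpow_Ioc (w := 3 * s - 2) (by simp; linarith)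
  have i2 : ∀ k : ℕ, _ := fun k ↦ integral_cpow_Ioc (w := 2 * s - 1 + k)
    (by simp; linarith [k.cast_nonneg (α := ℝ)])
  have i3 : ∀ k l : ℕ, _ := fun k l ↦ integral_cpow_Ioc (w := s + k + l)
    (by simp; linarith [k.cast_nonneg (α := ℝ), l.cast_nonneg (α := ℝ)])
  have j1 := i1.1.const_mul (Complex.Gamma (1 - s) ^ 2 * (x : ℂ) ^ (s - 1))
  have j2 : ∀ k ∈ Finset.range N, _ := fun k _ ↦ (i2 k).1.const_mul
    (Complex.Gamma (1 - s) * polylogCoeff k s * ((x : ℂ) ^ k + (x : ℂ) ^ (s - 1)))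
  have j3 : ∀ k ∈ Finset.range N, ∀ l ∈ Finset.range N, _ := fun k _ l _ ↦ (i3 k l).1.const_mul
    (polylogCoeff k s * polylogCoeff l s * (x : ℂ) ^ l)
  have J2 := integrable_finsetSum _ j2
  have j3' : ∀ k ∈ Finset.range N, _ := fun k hk ↦ integrable_finsetSum _ (j3 k hk)
  have J3 := integrable_finsetSum _ j3'
  have j12 := j1.fun_add J2
  have hcongr : EqOn (thetaIntegrandMain x N s) _ (Ioc 0 1) := fun t ht ↦
    thetaIntegrandMain_eq_sum hx N s ht.1
  constructor
  · exact IntegrableOn.congr_fun (j12.fun_add J3) hcongr.symm measurableSet_Ioc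
  · rw [setIntegral_congr_fun measurableSet_Ioc hcongr, integral_add j12 J3,
      integral_add j1 J2, integral_finsetSum _ j2, integral_finsetSum _ j3', integral_const_mul,
      i1.2, thetaPolar]
    congr 1
    · congr 1
      · ring
      · refine Finset.sum_congr rfl fun k _ ↦ ?_
        rw [integral_const_mul, (i2 k).2]
        ring
    · refine Finset.sum_congr rfl fun k hk ↦ ?_
      rw [integral_finsetSum _ (j3 k hk)]
      refine Finset.sum_congr rfl fun l _ ↦ ?_
      rw [integral_const_mul, (i3 k l).2]
      ring

lemma integral_thetaIntegrand_Ioi {x : ℝ} (hx : 0 < x) {N : ℕ} {s : ℂ} (hs : 2 / 3 < s.re)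
    (hs1 : s.re < 1) (hN : 2 < N + 2 * s.re) :
    ∫ t in Ioi (0 : ℝ), thetaIntegrand x s t =
      (∫ t in Ioi (1 : ℝ), thetaIntegrand x s t) +
        (∫ t in Ioc (0 : ℝ) 1, thetaIntegrandRem x N s t) + thetaPolar x N s := by
  obtain ⟨m1, m2⟩ := integral_thetaIntegrandMain hx N hs
  have r1 := integrableOn_thetaIntegrandRem hx hs1 hN
  have hfun : thetaIntegrand x s = fun t ↦ thetaIntegrandMain x N s t + thetaIntegrandRem x N s t :=
    funext (thetaIntegrand_eq x N s)
  have hI : IntegrableOn (thetaIntegrand x s) (Ioc 0 1) := by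
    rw [hfun]
    exact m1.add r1
  rw [← Ioc_union_Ioi_eq_Ioi (zero_le_one (α := ℝ)), setIntegral_union (Ioc_disjoint_Ioi le_rfl)
    measurableSet_Ioi hI (integrableOn_thetaIntegrand_Ioi_one hx s)]
  have : ∫ t in Ioc (0 : ℝ) 1, thetaIntegrand x s t =
      thetaPolar x N s + ∫ t in Ioc (0 : ℝ) 1, thetaIntegrandRem x N s t := by
    rw [hfun, integral_add m1 r1, m2]
  rw [this]
  ring

/-! ### The double series and its Mellin representation. -/

lemma thetaLinear_pos {x : ℝ} (hx : 0 < x) (p : ℕ × ℕ) :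
    0 < ((p.1 : ℝ) + 1) + ((p.2 : ℝ) + 1) * x := by positivity

lemma norm_thetaTerm {x : ℝ} (hx : 0 < x) (s : ℂ) (p : ℕ × ℕ) :
    ‖thetaTerm s s s x p‖ = (((p.1 : ℝ) + 1) * ((p.2 : ℝ) + 1) *
      (((p.1 : ℝ) + 1) + ((p.2 : ℝ) + 1) * x)) ^ (-s.re) := by
  have h := thetaLinear_pos hx p
  have h3 : (((p.1 : ℂ) + 1) + ((p.2 : ℂ) + 1) * (x : ℂ)) =
      ((((p.1 : ℝ) + 1) + ((p.2 : ℝ) + 1) * x : ℝ) : ℂ) := by push_cast; rfl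
  rw [thetaTerm, norm_div, norm_one, norm_mul, norm_mul, norm_natCast_add_one_cpow,
    norm_natCast_add_one_cpow, h3, Complex.norm_cpow_eq_rpow_re_of_pos h, one_div,
    ← Real.mul_rpow (by positivity) (by positivity), ← Real.mul_rpow (by positivity) h.le,
    ← Real.rpow_neg (by positivity)]

/-- By the AM-GM inequality `a + bx ≥ √(abx)`, so the terms are dominated by a constant times
`(ab)^(-3σ/2)`, and `3σ/2 > 1`. -/
lemma summable_thetaBound {x : ℝ} (hx : 0 < x) {σ : ℝ} (hσ : 2 / 3 < σ) :
    Summable fun p : ℕ × ℕ ↦ (((p.1 : ℝ) + 1) * ((p.2 : ℝ) + 1) *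
      (((p.1 : ℝ) + 1) + ((p.2 : ℝ) + 1) * x)) ^ (-σ) := by
  have h1 := summable_nat_add_one_rpow (c := -(3 / 2 * σ)) (by linarith)
  have h2 := (h1.mul_of_nonneg h1 (fun n ↦ by positivity) (fun n ↦ by positivity)).mul_left
    (Real.sqrt x ^ (-σ))
  refine h2.of_nonneg_of_le (fun p ↦ by positivity) fun p ↦ ?_
  set a := (p.1 : ℝ) + 1
  set b := (p.2 : ℝ) + 1
  have ha : 0 < a := by positivity
  have hb : 0 < b := by positivity
  have hsx := Real.sqrt_pos.mpr hx
  have hsa := Real.sqrt_pos.mpr ha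
  have hsb := Real.sqrt_pos.mpr hb
  have key : Real.sqrt x * (a ^ (3 / 2 : ℝ) * b ^ (3 / 2 : ℝ)) ≤ a * b * (a + b * x) := by
    have e : ∀ c : ℝ, 0 < c → c ^ (3 / 2 : ℝ) = c * Real.sqrt c := fun c hc ↦ by
      rw [Real.sqrt_eq_rpow, ← Real.rpow_one_add' hc.le (by norm_num)]
      norm_num
    rw [e a ha, e b hb]
    have : Real.sqrt x * (Real.sqrt a * Real.sqrt b) ≤ a + b * x := by
      have h3 := Real.sq_sqrt hx.le
      have h4 := Real.sq_sqrt ha.le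
      have h5 := Real.sq_sqrt hb.le
      have h6 : b * x = (Real.sqrt b * Real.sqrt x) ^ 2 := by rw [mul_pow, h3, h5]
      nlinarith [sq_nonneg (Real.sqrt a - Real.sqrt b * Real.sqrt x),
        mul_pos hsa (mul_pos hsb hsx)]
    have hab := mul_pos ha hb
    calc _ = a * b * (Real.sqrt x * (Real.sqrt a * Real.sqrt b)) := by ring
      _ ≤ _ := by gcongr
  calc _ ≤ (Real.sqrt x * (a ^ (3 / 2 : ℝ) * b ^ (3 / 2 : ℝ))) ^ (-σ) :=
        Real.rpow_le_rpow_of_nonpos (by positivity) key (by linarith)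
    _ = _ := by
        rw [Real.mul_rpow hsx.le (by positivity), Real.mul_rpow (by positivity) (by positivity),
          ← Real.rpow_mul ha.le, ← Real.rpow_mul hb.le]
        ring_nf

lemma summable_thetaTerm {x : ℝ} (hx : 0 < x) {s : ℂ} (hs : 2 / 3 < s.re) :
    Summable (thetaTerm s s s x) := by
  refine Summable.of_norm ?_
  simp_rw [norm_thetaTerm hx]
  exact summable_thetaBound hx hs

noncomputable def thetaSeries (x : ℝ) (s : ℂ) : ℂ := ∑' p, thetaTerm s s s x p

lemma isOpen_re_gt (c : ℝ) : IsOpen {s : ℂ | c < s.re} :=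
  isOpen_lt continuous_const Complex.continuous_re

lemma analyticAt_thetaSeries {x : ℝ} (hx : 0 < x) {s : ℂ} (hs : 2 / 3 < s.re) :
    AnalyticAt ℂ (thetaSeries x) s := by
  obtain ⟨σ, h1, h2⟩ := exists_between hs
  have hd : DifferentiableOn ℂ (thetaSeries x) {s | σ < s.re} := by
    refine Complex.differentiableOn_tsum_of_summable_norm (summable_thetaBound hx h1)
      (fun p ↦ ?_) (isOpen_re_gt σ) fun p z hz ↦ ?_
    · have n1 : (p.1 : ℂ) + 1 ≠ 0 := Nat.cast_add_one_ne_zero _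
      have n2 : (p.2 : ℂ) + 1 ≠ 0 := Nat.cast_add_one_ne_zero _
      have n3 : (((p.1 : ℂ) + 1) + ((p.2 : ℂ) + 1) * (x : ℂ)) ≠ 0 := by
        have : (((p.1 : ℂ) + 1) + ((p.2 : ℂ) + 1) * (x : ℂ)) =
          ((((p.1 : ℝ) + 1) + ((p.2 : ℝ) + 1) * x : ℝ) : ℂ) := by push_cast; rfl
        rw [this]
        exact Complex.ofReal_ne_zero.mpr (thetaLinear_pos hx p).ne'
      intro z _
      refine DifferentiableAt.differentiableWithinAt ?_
      refine (differentiableAt_const _).div ?_ ?_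
      · exact ((differentiableAt_id.const_cpow (Or.inl n1)).mul
          (differentiableAt_id.const_cpow (Or.inl n2))).mul
          (differentiableAt_id.const_cpow (Or.inl n3))
      · simp [Complex.cpow_eq_zero_iff, n1, n2, n3]
    · rw [norm_thetaTerm hx]
      have hz' : σ < z.re := hz
      -- The base is at least `1`, so the norm decreases as `Re z` grows.
      refine Real.rpow_le_rpow_of_exponent_le ?_ (by linarith)
      have hp1 := p.1.cast_nonneg (α := ℝ)
      have hp2 := p.2.cast_nonneg (α := ℝ)
      have h3 : (1 : ℝ) ≤ ((p.1 : ℝ) + 1) + ((p.2 : ℝ) + 1) * x := by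
        have : 0 ≤ ((p.2 : ℝ) + 1) * x := by positivity
        linarith
      exact one_le_mul_of_one_le_of_one_le
        (one_le_mul_of_one_le_of_one_le (by linarith) (by linarith)) h3
  exact hd.analyticAt ((isOpen_re_gt σ).mem_nhds h2)

lemma hasSum_mul_of_summable_norm {f g : ℕ → ℂ} {a b : ℂ} (hf : HasSum f a) (hg : HasSum g b)
    (hf' : Summable fun n ↦ ‖f n‖) (hg' : Summable fun n ↦ ‖g n‖) :
    HasSum (fun p : ℕ × ℕ ↦ f p.1 * g p.2) (a * b) :=
  hf.mul hg (summable_mul_of_summable_norm hf' hg')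

/-- Termwise this is `Γ(s) λ^(-s) = ∫ t^(s-1) e^{-λt} dt` with `λ = n + mx`; absolute convergence
justifies the interchange. -/
lemma Gamma_mul_thetaSeries {x : ℝ} (hx : 0 < x) {s : ℂ} (hs : 2 / 3 < s.re) :
    Complex.Gamma s * thetaSeries x s = ∫ t in Ioi (0 : ℝ), thetaIntegrand x s t := by
  have hF : ∀ t ∈ Ioi (0 : ℝ), HasSum (fun p : ℕ × ℕ ↦
      (((p.1 : ℂ) + 1) ^ (-s) * ((p.2 : ℂ) + 1) ^ (-s)) *
        (Real.exp (-(((p.1 : ℝ) + 1) + ((p.2 : ℝ) + 1) * x) * t) : ℂ))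
      (polylogExp s t * polylogExp s (x * t)) := by
    intro t ht
    have ht0 : 0 < t := ht
    have hxt := mul_pos hx ht0
    have h := hasSum_mul_of_summable_norm (hasSum_polylogExp s ht0) (hasSum_polylogExp s hxt)
        (summable_norm_polylogExp_term s ht0) (summable_norm_polylogExp_term s hxt)
    refine (congrArg (HasSum · _) (funext fun p ↦ ?_)).mpr h
    have he : Real.exp (-(((p.1 : ℝ) + 1) + ((p.2 : ℝ) + 1) * x) * t) =
        Real.exp (-((p.1 : ℝ) + 1) * t) * Real.exp (-((p.2 : ℝ) + 1) * (x * t)) := by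
      rw [← Real.exp_add]
      ring_nf
    rw [he, Complex.ofReal_mul]
    ring
  have h := hasSum_mellin (a := fun p : ℕ × ℕ ↦ ((p.1 : ℂ) + 1) ^ (-s) * ((p.2 : ℂ) + 1) ^ (-s))
    (p := fun p : ℕ × ℕ ↦ ((p.1 : ℝ) + 1) + ((p.2 : ℝ) + 1) * x) (s := s)
    (fun p ↦ Or.inr (thetaLinear_pos hx p)) (by linarith) hF ?_
  · rw [thetaSeries, ← tsum_mul_left]
    refine Eq.trans (tsum_congr fun p ↦ ?_) h.tsum_eq
    rw [thetaTerm, Complex.cpow_neg, Complex.cpow_neg]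
    push_cast
    field_simp
  · refine (summable_thetaBound hx hs).congr fun p ↦ ?_
    have hp := thetaLinear_pos hx p
    rw [norm_mul, norm_natCast_add_one_cpow, norm_natCast_add_one_cpow, Complex.neg_re,
      div_eq_mul_inv, ← Real.rpow_neg hp.le, Real.mul_rpow (by positivity) hp.le,
      Real.mul_rpow (by positivity) (by positivity)]

/-! ### Gluing the strips; uniqueness of the continuation. -/

/-- The continuation of the diagonal series to a vertical strip whose width grows with `N`. -/
noncomputable def thetaStrip (x : ℝ) (N : ℕ) (s : ℂ) : ℂ :=
  (Complex.Gamma s)⁻¹ * ((∫ t in Ioi (1 : ℝ), thetaIntegrand x s t) +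
    (∫ t in Ioc (0 : ℝ) 1, thetaIntegrandRem x N s t) + thetaPolar x N s)

lemma thetaStrip_eq_thetaSeries {x : ℝ} (hx : 0 < x) {N : ℕ} {s : ℂ} (hs : 2 / 3 < s.re)
    (hs1 : s.re < 1) (hN : 2 < N + 2 * s.re) : thetaStrip x N s = thetaSeries x s := by
  have hG : Complex.Gamma s ≠ 0 := Complex.Gamma_ne_zero_of_re_pos (by linarith)
  rw [thetaStrip, ← integral_thetaIntegrand_Ioi hx hs hs1 hN, ← Gamma_mul_thetaSeries hx hs,
    inv_mul_cancel_left₀ hG]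

lemma meromorphicAt_thetaPolar {x : ℝ} (hx : 0 < x) (N : ℕ) {s : ℂ} (hs : s.re < 1) :
    MeromorphicAt (thetaPolar x N) s := by
  have hG := (analyticAt_Gamma_one_sub hs).meromorphicAt
  have hX := (analyticAt_ofReal_cpow hx s).meromorphicAt
  have hc : ∀ k, MeromorphicAt (polylogCoeff k) s := fun k ↦
    (analyticAt_polylogCoeff k hs).meromorphicAt
  refine MeromorphicAt.fun_add (MeromorphicAt.fun_add ?_ ?_) ?_
  · exact ((hG.fun_pow 2).fun_mul hX).fun_div (by fun_prop)
  · refine MeromorphicAt.fun_sum fun k _ ↦ ?_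
    exact ((hG.fun_mul (hc k)).fun_mul ((MeromorphicAt.const _ _).fun_add hX)).fun_div (by fun_prop)
  · refine MeromorphicAt.fun_sum fun k _ ↦ MeromorphicAt.fun_sum fun l _ ↦ ?_
    exact (((hc k).fun_mul (hc l)).fun_mul (MeromorphicAt.const _ _)).fun_div (by fun_prop)

lemma meromorphicAt_thetaStrip {x : ℝ} (hx : 0 < x) {N : ℕ} {s : ℂ} (hs : s.re < 1)
    (hN : 2 < N + 2 * s.re) : MeromorphicAt (thetaStrip x N) s := by
  have hG : AnalyticAt ℂ (fun s ↦ (Complex.Gamma s)⁻¹) s :=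
    Complex.differentiable_one_div_Gamma.analyticAt s
  exact hG.meromorphicAt.fun_mul (((analyticAt_integral_thetaIntegrand hx s).meromorphicAt.fun_add
    (analyticAt_integral_thetaIntegrandRem hx hs hN).meromorphicAt).fun_add
    (meromorphicAt_thetaPolar hx N hs))

/-- On a connected set the order of `f - g` is infinite everywhere or nowhere. -/
lemma eventuallyEq_of_meromorphicOn {f g : ℂ → ℂ} {U : Set ℂ} (hf : MeromorphicOn f U)
    (hg : MeromorphicOn g U) (hU : IsPreconnected U) {z₀ z : ℂ} (hz₀ : z₀ ∈ U) (hz : z ∈ U)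
    (h : ∀ᶠ w in 𝓝[≠] z₀, f w = g w) : ∀ᶠ w in 𝓝[≠] z, f w = g w := by
  have hfg : MeromorphicOn (fun w ↦ f w - g w) U := fun w hw ↦ (hf w hw).fun_sub (hg w hw)
  have h0 : meromorphicOrderAt (fun w ↦ f w - g w) z₀ = ⊤ :=
    meromorphicOrderAt_eq_top_iff.mpr (h.mono fun w hw ↦ sub_eq_zero.mpr hw)
  have h1 : meromorphicOrderAt (fun w ↦ f w - g w) z = ⊤ := by
    by_contra hne
    have hall := (hfg.exists_meromorphicOrderAt_ne_top_iff_forall ⟨⟨z, hz⟩, hU⟩).mp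
      ⟨⟨z, hz⟩, hne⟩ ⟨z₀, hz₀⟩
    exact hall h0
  exact (meromorphicOrderAt_eq_top_iff.mp h1).mono fun w hw ↦ sub_eq_zero.mp hw

/-- `thetaStrip`, extended to the right by the series. -/
noncomputable def thetaHalfPlane (x : ℝ) (N : ℕ) (s : ℂ) : ℂ :=
  open Classical in if 2 / 3 < s.re then thetaSeries x s else thetaStrip x N s

lemma thetaHalfPlane_eventuallyEq_series (x : ℝ) (N : ℕ) {s : ℂ} (hs : 2 / 3 < s.re) :
    thetaHalfPlane x N =ᶠ[𝓝 s] thetaSeries x := by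
  filter_upwards [(isOpen_re_gt (2 / 3)).mem_nhds hs] with z hz
  exact if_pos hz

lemma thetaHalfPlane_eventuallyEq_strip {x : ℝ} (hx : 0 < x) {N : ℕ} {s : ℂ} (hs : s.re < 1)
    (hN : 2 < N + 2 * s.re) : thetaHalfPlane x N =ᶠ[𝓝 s] thetaStrip x N := by
  have e1 : ∀ᶠ z : ℂ in 𝓝 s, z.re < 1 :=
    Complex.continuous_re.continuousAt.eventually_lt_const hs
  have e2 : ∀ᶠ z : ℂ in 𝓝 s, 1 - (N : ℝ) / 2 < z.re :=
    Complex.continuous_re.continuousAt.eventually_const_lt (by linarith)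
  filter_upwards [e1, e2] with z h1 h2
  by_cases h : 2 / 3 < z.re
  · rw [thetaHalfPlane, if_pos h, thetaStrip_eq_thetaSeries hx h h1 (by linarith)]
  · rw [thetaHalfPlane, if_neg h]

lemma meromorphicAt_thetaHalfPlane {x : ℝ} (hx : 0 < x) {N : ℕ} {s : ℂ}
    (hN : 2 < N + 2 * s.re) : MeromorphicAt (thetaHalfPlane x N) s := by
  by_cases h : 2 / 3 < s.re
  · exact (analyticAt_thetaSeries hx h).meromorphicAt.congr
      ((thetaHalfPlane_eventuallyEq_series x N h).symm.filter_mono nhdsWithin_le_nhds)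
  · have h1 : s.re < 1 := by linarith
    exact (meromorphicAt_thetaStrip hx h1 hN).congr
      ((thetaHalfPlane_eventuallyEq_strip hx h1 hN).symm.filter_mono nhdsWithin_le_nhds)

/-- Two functions that agree with the series for `2 / 3 < re s` agree in every half-plane
to which both extend meromorphically. -/
lemma eventuallyEq_of_eq_thetaSeries {f g : ℂ → ℂ} {x c : ℝ}
    (hf : ∀ s : ℂ, c < s.re → MeromorphicAt f s) (hg : ∀ s : ℂ, c < s.re → MeromorphicAt g s)
    (hf' : ∀ s : ℂ, 2 / 3 < s.re → f s = thetaSeries x s)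
    (hg' : ∀ s : ℂ, 2 / 3 < s.re → g s = thetaSeries x s) {s : ℂ} (hs : c < s.re) :
    ∀ᶠ w in 𝓝[≠] s, f w = g w := by
  refine eventuallyEq_of_meromorphicOn (U := {s | c < s.re}) hf hg
    (convex_halfSpace_re_gt c).isPreconnected (z₀ := ((max c (2 / 3) + 1 : ℝ) : ℂ)) ?_ hs ?_
  · have := le_max_left c (2 / 3)
    simp only [mem_ofPred_eq, Complex.ofReal_re]
    linarith
  · refine Eventually.filter_mono nhdsWithin_le_nhds ?_
    have : (2 / 3 : ℝ) < ((max c (2 / 3) + 1 : ℝ) : ℂ).re := by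
      have := le_max_right c (2 / 3)
      simp only [Complex.ofReal_re]
      linarith
    filter_upwards [(isOpen_re_gt (2 / 3)).mem_nhds this] with z hz
    rw [hf' z hz, hg' z hz]

/-- Large enough that `2 < N + 2 Re s`, with slack to spare for all points within distance one. -/
noncomputable def stripIndex (s : ℂ) : ℕ := 2 * ⌈‖s‖⌉₊ + 6

/-- The meromorphic continuation of the diagonal series to the whole plane. -/
noncomputable def thetaContinuation (x : ℝ) (s : ℂ) : ℂ := thetaHalfPlane x (stripIndex s) s

lemma thetaContinuation_eventuallyEq {x : ℝ} (hx : 0 < x) {N : ℕ} {s : ℂ}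
    (hN : 2 < N + 2 * s.re) :
    ∀ᶠ w in 𝓝[≠] s, thetaContinuation x w = thetaHalfPlane x N w := by
  have hle : ∀ᶠ w : ℂ in 𝓝 s, ‖w‖ < ‖s‖ + 1 :=
    continuous_norm.continuousAt.eventually_lt_const (by linarith)
  have hge : ∀ᶠ w : ℂ in 𝓝 s, ‖s‖ - 1 < ‖w‖ :=
    continuous_norm.continuousAt.eventually_const_lt (by linarith)
  -- `stripIndex` is locally bounded, so only finitely many indices `K` occur near `s`, and their
  -- punctured neighbourhoods can be intersected.
  have hall : ∀ᶠ w in 𝓝[≠] s, ∀ K ∈ Finset.range (2 * ⌈‖s‖ + 1⌉₊ + 7), 2 < K + 2 * s.re →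
      thetaHalfPlane x K w = thetaHalfPlane x N w := by
    rw [Filter.eventually_all_finset]
    intro K _
    rw [eventually_imp_distrib_left]
    intro hK
    refine eventuallyEq_of_eq_thetaSeries (x := x) (c := max (1 - (K : ℝ) / 2) (1 - (N : ℝ) / 2))
      (fun z hz ↦ ?_) (fun z hz ↦ ?_) (fun z hz ↦ if_pos hz) (fun z hz ↦ if_pos hz) ?_
    · refine meromorphicAt_thetaHalfPlane hx ?_
      linarith [le_max_left (1 - (K : ℝ) / 2) (1 - (N : ℝ) / 2)]
    · refine meromorphicAt_thetaHalfPlane hx ?_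
      linarith [le_max_right (1 - (K : ℝ) / 2) (1 - (N : ℝ) / 2)]
    · exact max_lt (by linarith) (by linarith)
  filter_upwards [hall, hle.filter_mono nhdsWithin_le_nhds, hge.filter_mono nhdsWithin_le_nhds]
    with w hw h1 h2
  refine hw (stripIndex w) ?_ ?_
  · have := Nat.ceil_mono h1.le
    simp only [stripIndex, Finset.mem_range]
    omega
  · have h3 := Nat.le_ceil ‖w‖
    have h4 := (abs_le.mp (Complex.abs_re_le_norm s)).1
    rw [stripIndex]
    push_cast
    linarith

lemma isThetaDiagContinuation_thetaContinuation {x : ℝ} (hx : 0 < x) :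
    IsThetaDiagContinuation x (thetaContinuation x) where
  meromorphicAt s := by
    obtain ⟨N, hN⟩ := exists_nat_gt (2 - 2 * s.re)
    exact (meromorphicAt_thetaHalfPlane hx (N := N) (by linarith)).congr
      ((thetaContinuation_eventuallyEq hx (by linarith)).mono fun w hw ↦ hw.symm)
  hasSum s hs := by
    rw [thetaContinuation, thetaHalfPlane, if_pos hs]
    exact (summable_thetaTerm hx hs).hasSum

/-- Uniqueness: the limits of an arbitrary continuation can be computed from the explicit strip
formula. -/
lemma eventuallyEq_thetaStrip_of_isThetaDiagContinuation {x : ℝ} (hx : 0 < x) {F : ℂ → ℂ}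
    (hF : IsThetaDiagContinuation x F) {N : ℕ} {s : ℂ} (hs : s.re < 1) (hN : 2 < N + 2 * s.re) :
    ∀ᶠ w in 𝓝[≠] s, F w = thetaStrip x N w := by
  have h1 : ∀ᶠ w in 𝓝[≠] s, F w = thetaHalfPlane x N w := by
    refine eventuallyEq_of_eq_thetaSeries (x := x) (c := 1 - (N : ℝ) / 2)
      (fun z _ ↦ hF.meromorphicAt z) (fun z hz ↦ meromorphicAt_thetaHalfPlane hx (by linarith))
      (fun z hz ↦ (hF.hasSum z hz).tsum_eq.symm) (fun z hz ↦ if_pos hz) (by linarith)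
  filter_upwards [h1, (thetaHalfPlane_eventuallyEq_strip hx hs hN).filter_mono nhdsWithin_le_nhds]
    with w h2 h3
  rw [h2, h3]

/-! ### Limits at the non-positive integers. -/

/-- The derivative of `1/Γ` at its zero `-j`, by induction from `1/Γ(s) = s/Γ(s+1)`. -/
lemma tendsto_Gamma_inv_div (j : ℕ) :
    Tendsto (fun s : ℂ ↦ (Complex.Gamma s)⁻¹ / (s + j)) (𝓝[≠] (-(j : ℂ)))
      (𝓝 ((-1) ^ j * j.factorial)) := by
  induction j with
  | zero =>
    have h := Complex.tendsto_self_mul_Gamma_nhds_zero.inv₀ one_ne_zero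
    simpa [mul_inv, div_eq_mul_inv, mul_comm] using h
  | succ j ih =>
    have hshift : Tendsto (fun s : ℂ ↦ s + 1) (𝓝[≠] (-((j + 1 : ℕ) : ℂ))) (𝓝[≠] (-(j : ℂ))) := by
      refine tendsto_nhdsWithin_iff.mpr ⟨?_, ?_⟩
      · have : Tendsto (fun s : ℂ ↦ s + 1) (𝓝 (-((j + 1 : ℕ) : ℂ)))
            (𝓝 (-((j + 1 : ℕ) : ℂ) + 1)) := tendsto_id.add tendsto_const_nhds
        rw [show -((j + 1 : ℕ) : ℂ) + 1 = -j by push_cast; ring] at this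
        exact this.mono_left nhdsWithin_le_nhds
      · filter_upwards [self_mem_nhdsWithin] with s hs h
        apply hs
        rw [mem_singleton_iff] at h ⊢
        push_cast
        linear_combination h
    have hid : Tendsto (fun s : ℂ ↦ s) (𝓝[≠] (-((j + 1 : ℕ) : ℂ))) (𝓝 (-((j + 1 : ℕ) : ℂ))) :=
      tendsto_id.mono_left nhdsWithin_le_nhds
    have h := hid.mul (ih.comp hshift)
    convert! h using 1
    · funext s
      rw [Complex.one_div_Gamma_eq_self_mul_one_div_Gamma_add_one s]
      simp only [Function.comp_apply]
      push_cast
      rw [show s + 1 + (j : ℂ) = s + (j + 1) by ring, mul_div_assoc]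
    · rw [Nat.factorial_succ, pow_succ]
      push_cast
      ring_nf

lemma tendsto_Gamma_inv_nhds_zero (j : ℕ) :
    Tendsto (fun s : ℂ ↦ (Complex.Gamma s)⁻¹) (𝓝[≠] (-(j : ℂ))) (𝓝 0) := by
  have h := (Complex.differentiable_one_div_Gamma.continuous.tendsto (-(j : ℂ)))
  -- The conventions `Γ(-j) = 0` and `0⁻¹ = 0` give `(Γ s)⁻¹` the value of the entire function `1/Γ`
  -- here.
  simp only [Complex.Gamma_neg_nat_eq_zero, inv_zero] at h
  exact h.mono_left nhdsWithin_le_nhds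

/-- Either the denominator vanishes at `-j` and cancels the zero of `1/Γ`, or it does not and the
zero wins. -/
lemma tendsto_Gamma_inv_mul_polar (j : ℕ) {c : ℂ → ℂ} (hc : ContinuousAt c (-(j : ℂ))) {a b v : ℂ}
    (ha : a ≠ 0) (hv : (a * -(j : ℂ) + b = 0 ∧ v = c (-j) / a * ((-1) ^ j * j.factorial)) ∨
      (a * -(j : ℂ) + b ≠ 0 ∧ v = 0)) :
    Tendsto (fun s : ℂ ↦ (Complex.Gamma s)⁻¹ * (c s / (a * s + b))) (𝓝[≠] (-(j : ℂ))) (𝓝 v) := by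
  have hc' := hc.tendsto.mono_left (nhdsWithin_le_nhds (s := {(-(j : ℂ))}ᶜ))
  rcases hv with ⟨h, rfl⟩ | ⟨h, rfl⟩
  · refine ((hc'.div_const a).mul (tendsto_Gamma_inv_div j)).congr fun s ↦ ?_
    rw [show a * s + b = a * (s + j) by linear_combination h]
    field_simp
  · have hl : Tendsto (fun s : ℂ ↦ a * s + b) (𝓝[≠] (-(j : ℂ))) (𝓝 (a * -(j : ℂ) + b)) :=
      ((tendsto_id.const_mul a).add_const b).mono_left nhdsWithin_le_nhds
    simpa using (tendsto_Gamma_inv_nhds_zero j).mul (hc'.div hl h)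

lemma tendsto_Gamma_inv_mul_thetaPolar {x : ℝ} (hx : 0 < x) (N j : ℕ) :
    Tendsto (fun s ↦ (Complex.Gamma s)⁻¹ * thetaPolar x N s) (𝓝[≠] (-(j : ℂ)))
      (𝓝 ((∑ k ∈ Finset.range N, if k = 2 * j + 1 then
          Complex.Gamma (1 - -(j : ℂ)) * polylogCoeff k (-j) *
            ((x : ℂ) ^ k + (x : ℂ) ^ (-(j : ℂ) - 1)) / 2 * ((-1) ^ j * j.factorial) else 0) +
        ∑ k ∈ Finset.range N, ∑ l ∈ Finset.range N, if k + l = j then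
          polylogCoeff k (-j) * polylogCoeff l (-j) * (x : ℂ) ^ l / 1 *
            ((-1) ^ j * j.factorial) else 0)) := by
  have hj := j.cast_nonneg (α := ℝ)
  have hre : (-(j : ℂ)).re < 1 := by simp; linarith
  have hG := (analyticAt_Gamma_one_sub hre).continuousAt
  have hX := (analyticAt_ofReal_cpow hx (-(j : ℂ))).continuousAt
  have hP : ∀ k, ContinuousAt (polylogCoeff k) (-(j : ℂ)) := fun k ↦
    (analyticAt_polylogCoeff k hre).continuousAt
  -- The denominator `3s - 2` has no zero at a non-positive integer, so this term vanishes in the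
  -- limit.
  have t1 := tendsto_Gamma_inv_mul_polar j (c := fun s ↦ Complex.Gamma (1 - s) ^ 2 *
    (x : ℂ) ^ (s - 1)) ((hG.pow 2).mul hX) (a := 3) (b := -2) (v := 0) (by norm_num)
    (Or.inr ⟨fun h ↦ by
      have := congrArg Complex.re h
      simp at this
      linarith, rfl⟩)
  have t2 : ∀ k ∈ Finset.range N, Tendsto (fun s ↦ (Complex.Gamma s)⁻¹ *
      (Complex.Gamma (1 - s) * polylogCoeff k s * ((x : ℂ) ^ k + (x : ℂ) ^ (s - 1)) /
        (2 * s + (-1 + k)))) (𝓝[≠] (-(j : ℂ))) (𝓝 (if k = 2 * j + 1 then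
          Complex.Gamma (1 - -(j : ℂ)) * polylogCoeff k (-j) *
            ((x : ℂ) ^ k + (x : ℂ) ^ (-(j : ℂ) - 1)) / 2 * ((-1) ^ j * j.factorial) else 0)) := by
    intro k _
    refine tendsto_Gamma_inv_mul_polar j (c := fun s ↦ Complex.Gamma (1 - s) * polylogCoeff k s *
      ((x : ℂ) ^ k + (x : ℂ) ^ (s - 1))) ((hG.mul (hP k)).mul (continuousAt_const.add hX))
      two_ne_zero ?_
    by_cases h : k = 2 * j + 1
    · left
      rw [if_pos h, h]
      push_cast
      exact ⟨by ring, rfl⟩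
    · right
      rw [if_neg h]
      refine ⟨fun h' ↦ h ?_, rfl⟩
      have : (k : ℂ) = ((2 * j + 1 : ℕ) : ℂ) := by
        push_cast
        linear_combination h'
      exact_mod_cast this
  have t3 : ∀ k ∈ Finset.range N, ∀ l ∈ Finset.range N, Tendsto (fun s ↦ (Complex.Gamma s)⁻¹ *
      (polylogCoeff k s * polylogCoeff l s * (x : ℂ) ^ l / (1 * s + (k + l))))
      (𝓝[≠] (-(j : ℂ))) (𝓝 (if k + l = j then
          polylogCoeff k (-j) * polylogCoeff l (-j) * (x : ℂ) ^ l / 1 *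
            ((-1) ^ j * j.factorial) else 0)) := by
    intro k _ l _
    refine tendsto_Gamma_inv_mul_polar j (c := fun s ↦ polylogCoeff k s * polylogCoeff l s *
      (x : ℂ) ^ l) (((hP k).mul (hP l)).mul continuousAt_const) one_ne_zero ?_
    by_cases h : k + l = j
    · left
      rw [if_pos h, ← h]
      push_cast
      exact ⟨by ring, rfl⟩
    · right
      rw [if_neg h]
      refine ⟨fun h' ↦ h ?_, rfl⟩
      have : ((k + l : ℕ) : ℂ) = (j : ℂ) := by
        push_cast
        linear_combination h'
      exact_mod_cast this
  have t := (t1.add (tendsto_finsetSum _ t2)).add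
    (tendsto_finsetSum _ fun k hk ↦ tendsto_finsetSum _ (t3 k hk))
  rw [zero_add] at t
  refine t.congr fun s ↦ ?_
  rw [thetaPolar, mul_add, mul_add, Finset.mul_sum, Finset.mul_sum]
  congr 1
  · refine congrArg₂ _ (by ring_nf) (Finset.sum_congr rfl fun k _ ↦ ?_)
    rw [show 2 * s + (-1 + (k : ℂ)) = 2 * s - 1 + k by ring]
  · refine Finset.sum_congr rfl fun k _ ↦ ?_
    rw [Finset.mul_sum]
    refine Finset.sum_congr rfl fun l _ ↦ ?_
    rw [show 1 * s + ((k : ℂ) + l) = s + k + l by ring]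

lemma sum_range_antidiagonal_ite {N j : ℕ} (h : j < N) (f : ℕ → ℕ → ℂ) :
    (∑ k ∈ Finset.range N, ∑ l ∈ Finset.range N, if k + l = j then f k l else 0) =
      ∑ k ∈ Finset.range (j + 1), f k (j - k) := by
  have h1 : ∀ k ∈ Finset.range (j + 1), f k (j - k) =
      ∑ l ∈ Finset.range N, if k + l = j then f k l else 0 := by
    intro k hk
    rw [Finset.mem_range] at hk
    rw [Finset.sum_eq_single_of_mem (j - k) (Finset.mem_range.mpr (by omega))
      fun l _ hl ↦ if_neg (by omega), if_pos (by omega)]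
  rw [Finset.sum_congr rfl h1]
  refine (Finset.sum_subset (Finset.range_subset_range.mpr (by omega)) fun k _ hk ↦ ?_).symm
  rw [Finset.mem_range] at hk
  exact Finset.sum_eq_zero fun l _ ↦ if_neg (by omega)

/-! ### Evaluation of the limit and parity. -/

/-- The value of the continued diagonal series at `-j`, for either parity of `j`. -/
noncomputable def thetaValue (x : ℝ) (j : ℕ) : ℂ :=
  -(-1) ^ j * (((j.factorial : ℂ) ^ 2) / (2 * ((2 * j + 1).factorial : ℂ))) *
      ((x : ℂ) ^ (2 * j + 1) + (x : ℂ) ^ (-(j : ℤ) - 1)) * riemannZeta (-3 * (j : ℂ) - 1) +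
    ∑ k ∈ Finset.range (j + 1), (j.choose k : ℂ) * (x : ℂ) ^ (j - k) *
      riemannZeta (-(j : ℂ) - (k : ℂ)) * riemannZeta (-2 * (j : ℂ) + (k : ℂ))

/-- The factorials combine to a binomial coefficient, and the signs `(-1)^k (-1)^(j-k) (-1)^j`
cancel. -/
lemma polylogCoeff_mul_eq {j k : ℕ} (hk : k ≤ j) (y : ℂ) :
    polylogCoeff k (-j) * polylogCoeff (j - k) (-j) * y / 1 * ((-1) ^ j * j.factorial) =
      j.choose k * y * riemannZeta (-(j : ℂ) - k) * riemannZeta (-2 * (j : ℂ) + k) := by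
  have h1 : (k.factorial : ℂ) ≠ 0 := Nat.cast_ne_zero.mpr k.factorial_ne_zero
  have h2 : ((j - k).factorial : ℂ) ≠ 0 := Nat.cast_ne_zero.mpr (j - k).factorial_ne_zero
  have h3 : (j.choose k : ℂ) * k.factorial * (j - k).factorial = j.factorial := by
    exact_mod_cast Nat.choose_mul_factorial_mul_factorial hk
  have h4 : ((-1 : ℂ)) ^ k * (-1) ^ (j - k) = (-1) ^ j := by
    rw [← pow_add, Nat.add_sub_cancel' hk]
  have h5 : ((-1 : ℂ)) ^ j * (-1) ^ j = 1 := by rw [← mul_pow]; simp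
  have h6 : -(j : ℂ) - ((j - k : ℕ) : ℂ) = -2 * (j : ℂ) + k := by
    rw [Nat.cast_sub hk]
    ring
  rw [polylogCoeff, polylogCoeff, h6, ← h3]
  generalize riemannZeta (-(j : ℂ) - k) = u
  generalize riemannZeta (-2 * (j : ℂ) + k) = v
  field_simp
  linear_combination (u * v * y * j.choose k) * ((-1) ^ j * h4 + h5)

lemma tendsto_thetaStrip {x : ℝ} (hx : 0 < x) (j : ℕ) :
    Tendsto (thetaStrip x (2 * j + 4)) (𝓝[≠] (-(j : ℂ))) (𝓝 (thetaValue x j)) := by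
  have hj := j.cast_nonneg (α := ℝ)
  have hre : (-(j : ℂ)).re < 1 := by simp; linarith
  -- `N = 2j + 4` puts `-j` inside the strip and keeps the index `k = 2j + 1` in the sum.
  have hN : (2 : ℝ) < (2 * j + 4 : ℕ) + 2 * (-(j : ℂ)).re := by
    push_cast
    simp
    linarith
  have a1 := (analyticAt_integral_thetaIntegrand hx (-(j : ℂ))).continuousAt.tendsto.mono_left
    (nhdsWithin_le_nhds (s := {(-(j : ℂ))}ᶜ))
  have a2 := (analyticAt_integral_thetaIntegrandRem hx hre hN).continuousAt.tendsto.mono_left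
    (nhdsWithin_le_nhds (s := {(-(j : ℂ))}ᶜ))
  have h := ((tendsto_Gamma_inv_nhds_zero j).mul (a1.add a2)).add
    (tendsto_Gamma_inv_mul_thetaPolar hx (2 * j + 4) j)
  rw [zero_mul, zero_add, Finset.sum_ite_eq', if_pos (Finset.mem_range.mpr (by omega)),
    sum_range_antidiagonal_ite (by omega)] at h
  refine (h.congr fun s ↦ by rw [thetaStrip]; ring).trans (le_of_eq (congrArg 𝓝 ?_))
  rw [thetaValue]
  congr 1
  · have h1 : (x : ℂ) ^ (-(j : ℂ) - 1) = (x : ℂ) ^ (-(j : ℤ) - 1) := by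
      rw [← Complex.cpow_intCast]
      push_cast
      rfl
    have h2 : -(j : ℂ) - ((2 * j + 1 : ℕ) : ℂ) = -3 * (j : ℂ) - 1 := by
      push_cast
      ring
    have h3 : ((-1 : ℂ)) ^ (2 * j + 1) = -1 := by rw [pow_succ, pow_mul]; simp
    have h4 : ((2 * j + 1).factorial : ℂ) ≠ 0 := Nat.cast_ne_zero.mpr (Nat.factorial_ne_zero _)
    rw [h1, polylogCoeff, h2, h3, sub_neg_eq_add, add_comm 1, Complex.Gamma_nat_eq_factorial]
    field_simp
  · refine Finset.sum_congr rfl fun k hk ↦ ?_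
    rw [Finset.mem_range] at hk
    exact polylogCoeff_mul_eq (by omega) _

lemma riemannZeta_neg_even {n : ℕ} (hn : Even n) (h0 : n ≠ 0) : riemannZeta (-(n : ℂ)) = 0 := by
  obtain ⟨m, rfl⟩ := hn
  obtain ⟨l, rfl⟩ := Nat.exists_eq_succ_of_ne_zero (n := m) (by omega)
  rw [← riemannZeta_neg_two_mul_nat_add_one l]
  congr 1
  push_cast
  ring

/-- For odd `j`, `3j + 1` is even, and `j + k`, `2j - k` have odd sum `3j`; the even one is positive
because `k ≤ j` and `j ≥ 1`, so `ζ` has a trivial zero in every term. -/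
lemma thetaValue_odd (x : ℝ) {j : ℕ} (hj : Odd j) : thetaValue x j = 0 := by
  have h1 : riemannZeta (-3 * (j : ℂ) - 1) = 0 := by
    rw [← riemannZeta_neg_even (n := 3 * j + 1) (by grind) (by omega)]
    congr 1
    push_cast
    ring
  rw [thetaValue, h1, mul_zero, zero_add]
  refine Finset.sum_eq_zero fun k hk ↦ ?_
  rw [Finset.mem_range] at hk
  rcases Nat.even_or_odd k with h | h
  · have : riemannZeta (-2 * (j : ℂ) + k) = 0 := by
      rw [← riemannZeta_neg_even (n := 2 * j - k) (by grind) (by grind),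
        Nat.cast_sub (by omega)]
      congr 1
      push_cast
      ring
    rw [this, mul_zero]
  · have : riemannZeta (-(j : ℂ) - k) = 0 := by
      rw [← riemannZeta_neg_even (n := j + k) (by grind) (by grind)]
      congr 1
      push_cast
      ring
    rw [this, mul_zero, zero_mul]

lemma tendsto_of_isThetaDiagContinuation {x : ℝ} (hx : 0 < x) {F : ℂ → ℂ}
    (hF : IsThetaDiagContinuation x F) (j : ℕ) :
    Tendsto F (𝓝[≠] (-(j : ℂ))) (𝓝 (thetaValue x j)) := by
  refine (tendsto_thetaStrip hx j).congr' ?_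
  have hj := j.cast_nonneg (α := ℝ)
  filter_upwards [eventuallyEq_thetaStrip_of_isThetaDiagContinuation hx hF (N := 2 * j + 4)
    (s := -(j : ℂ)) (by simp; linarith) (by push_cast; simp; linarith)] with s hs using hs.symm

end MordellTornheim

theorem theorem9 (x : ℝ) (hx : 0 < x) :
    (∃ F : ℂ → ℂ, IsThetaDiagContinuation x F) ∧
    ∀ F : ℂ → ℂ, IsThetaDiagContinuation x F → ∀ j : ℕ,
      (Odd j → Tendsto F (𝓝[≠] (-(j : ℂ))) (𝓝 0)) ∧
      (Even j → Tendsto F (𝓝[≠] (-(j : ℂ))) (𝓝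
        (-(((j.factorial : ℂ) ^ 2) / (2 * ((2 * j + 1).factorial : ℂ))) *
            ((x : ℂ) ^ (2 * j + 1) + (x : ℂ) ^ (-(j : ℤ) - 1)) *
            riemannZeta (-3 * (j : ℂ) - 1) +
          ∑ k ∈ Finset.range (j + 1),
            (j.choose k : ℂ) * (x : ℂ) ^ (j - k) *
              riemannZeta (-(j : ℂ) - (k : ℂ)) * riemannZeta (-2 * (j : ℂ) + (k : ℂ))))) := by
  refine ⟨⟨_, MordellTornheim.isThetaDiagContinuation_thetaContinuation hx⟩, fun F hF j ↦ ?_⟩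
  have h := MordellTornheim.tendsto_of_isThetaDiagContinuation hx hF j
  refine ⟨fun hj ↦ ?_, fun hj ↦ ?_⟩
  · rwa [MordellTornheim.thetaValue_odd x hj] at h
  · rw [MordellTornheim.thetaValue, hj.neg_one_pow] at h
    simpa only [neg_mul, one_mul] using h
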